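/- Let $k$ be a commutative ring, let $A$ and $B$ be (associative, unital, not necessarily commutative) $k$-algebras, let $\mathfrak C$ be an $A$-coring and $\mathfrak D$ a $B$-coring (the bimodules being $k$-central), and write $\mathcal M^{\mathfrak C}$, $\mathcal M^{\mathfrak D}$ for the $k$-linear categories of right comodules. Let $F:\mathcal M^{\mathfrak C}\to\mathcal M^{\mathfrak D}$ be a $k$-linear functor. The comodule $F(\mathfrak C)$ is a left $A$-module, $a$ acting as $F(a\cdot -)$; for a right $A$-module $X$ let $$\Upsilon_{X,\mathfrak C}: X\otimes_A F(\mathfrak C)\to F(X\otimes_A\mathfrak C),\qquad x\otimes y\mapsto F(x\otimes -)(y),$$ be the natural comodule morphism, i.e. the unique natural transformation in $X$ that extends the canonical isomorphism $A\otimes_A F(\mathfrak C)\simeq F(\mathfrak C)\simeq F(A\otimes_A\mathfrak C)$. Suppose that at least one of the following holds: (I) ${}_B\mathfrak D$ is flat and, for every $N\in\mathcal M^{\mathfrak C}$ with coaction $\rho_N$, the functor $F$ preserves the kernel (in $\mathcal M^{\mathfrak C}$) of $\rho_N\otimes_A\mathfrak C-N\otimes_A\Delta_{\mathfrak C}:N\otimes_A\mathfrak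 C\to N\otimes_A\mathfrak C\otimes_A\mathfrak C$; (II) $\mathfrak C$ is coseparable (i.e. $\Delta_{\mathfrak C}$ has a retraction that is a morphism of $(\mathfrak C,\mathfrak C)$-bicomodules) and the categories $\mathcal M^{\mathfrak C}$ and $\mathcal M^{\mathfrak D}$ are abelian. Suppose moreover that at least one of the following holds: (1) $\mathfrak C_A$ is projective, $F$ preserves coproducts, and $\Upsilon_{N,\mathfrak C}$, $\Upsilon_{N\otimes_A\mathfrak C,\mathfrak C}$ are isomorphisms for all $N\in\mathcal M^{\mathfrak C}$; (2) $\mathfrak C_A$ is flat, $F$ preserves direct limits (colimits over directed sets), and $\Upsilon_{N,\mathfrak C}$, $\Upsilon_{N\otimes_A\mathfrak C,\mathfrak C}$ are isomorphisms for all $N\in\mathcal M^{\mathfrak C}$; (3) $F$ preserves inductive limits (all small colimits). Then there is a left coaction $\lambda$ of $\mathfrak C$ on $F(\mathfrak C)$ with $\Upsilon_{\mathfrak C,\mathfrak C}\circ\lambda=F(\Delta_{\mathfrak C})$ that makes $F(\mathfrak C)$ a $(\mathfrak C,\mathfrak D)$-bicomodule; the cotensor product $N\square_{\mathfrak C}F(\mathfrak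 C)=\ker(\rho_N\otimes_A F(\mathfrak C)-N\otimes_A\lambda)\subseteq N\otimes_AF(\mathfrak C)$ is, for every $N\in\mathcal M^{\mathfrak C}$, a right $\mathfrak D$-comodule by restriction of the coaction of $N\otimes_A F(\mathfrak C)$ (its defining kernel is preserved by $-\otimes_B\mathfrak D$, and its inclusion stays injective under $-\otimes_B\mathfrak D\otimes_B\mathfrak D$); and $F$ is naturally isomorphic to $-\square_{\mathfrak C}F(\mathfrak C)$. Furthermore, (1) holds if $A$ is semisimple and $F$ preserves coproducts; (2) holds if $A$ is von Neumann regular and $F$ preserves direct limits; (3) holds if $F$ has a right adjoint. -/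

import Mathlib

open CategoryTheory CategoryTheory.Limits MulOpposite

universe u

/-! ### Tensor products over a noncommutative ring

Right `A`-modules are modules over `Aᵐᵒᵖ`, so `m · a` is `op a • m`. -/

section Tensor

/-- The relations `m · a ⊗ n = m ⊗ a · n`. -/
def balancedRel (A : Type*) [Ring A] (M N : Type*) [AddCommGroup M] [Module Aᵐᵒᵖ M]
    [AddCommGroup N] [Module A N] : AddSubgroup (TensorProduct ℤ M N) :=
  AddSubgroup.closure {x | ∃ (m : M) (a : A) (n : N),
    x = TensorProduct.tmul ℤ (op a • m) n - TensorProduct.tmul ℤ m (a • n)}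

/-- The tensor product `M ⊗_A N` of a right and a left module over a ring `A`. -/
def Tens (A : Type*) [Ring A] (M N : Type*) [AddCommGroup M] [Module Aᵐᵒᵖ M]
    [AddCommGroup N] [Module A N] : Type _ :=
  TensorProduct ℤ M N ⧸ balancedRel A M N

namespace Tens

variable {A : Type*} [Ring A] {M N : Type*} [AddCommGroup M] [Module Aᵐᵒᵖ M]
  [AddCommGroup N] [Module A N]
variable {M' N' : Type*} [AddCommGroup M'] [Module Aᵐᵒᵖ M'] [AddCommGroup N'] [Module A N']
variable {M'' N'' : Type*} [AddCommGroup M''] [Module Aᵐᵒᵖ M''] [AddCommGroup N'']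
  [Module A N'']
variable {P : Type*} [AddCommGroup P]

instance : AddCommGroup (Tens A M N) :=
  inferInstanceAs (AddCommGroup (TensorProduct ℤ M N ⧸ balancedRel A M N))

/-- The pure tensor `m ⊗ n`. -/
def tmul (A : Type*) [Ring A] {M N : Type*} [AddCommGroup M] [Module Aᵐᵒᵖ M]
    [AddCommGroup N] [Module A N] (m : M) (n : N) : Tens A M N :=
  QuotientAddGroup.mk (s := balancedRel A M N) (TensorProduct.tmul ℤ m n)

/-! Shortcut instances. -/

instance : AddMonoidHomClass (Tens A M N →+ P) (Tens A M N) P :=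
  AddMonoidHom.instAddMonoidHomClass
instance : AddHomClass (Tens A M N →+ P) (Tens A M N) P :=
  AddMonoidHom.instAddMonoidHomClass.toAddHomClass
instance : ZeroHomClass (Tens A M N →+ P) (Tens A M N) P :=
  AddMonoidHom.instAddMonoidHomClass.toZeroHomClass
instance : AddHomClass (Tens A M N ≃+ P) (Tens A M N) P := inferInstance
instance : ZeroHomClass (Tens A M N ≃+ P) (Tens A M N) P := inferInstance

theorem add_tmul (m m' : M) (n : N) : tmul A (m + m') n = tmul A m n + tmul A m' n :=
  congrArg (QuotientAddGroup.mk (s := balancedRel A M N)) (TensorProduct.add_tmul m m' n)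

theorem tmul_add (m : M) (n n' : N) : tmul A m (n + n') = tmul A m n + tmul A m n' :=
  congrArg (QuotientAddGroup.mk (s := balancedRel A M N)) (TensorProduct.tmul_add m n n')

theorem smul_tmul (a : A) (m : M) (n : N) : tmul A (op a • m) n = tmul A m (a • n) := by
  have h : TensorProduct.tmul ℤ (op a • m) n - TensorProduct.tmul ℤ m (a • n)
      ∈ balancedRel A M N := AddSubgroup.subset_closure ⟨m, a, n, rfl⟩
  exact ((QuotientAddGroup.eq_iff_sub_mem).2 h)

@[elab_as_elim]
theorem induction_on {motive : Tens A M N → Prop} (x : Tens A M N)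
    (zero : motive 0) (tmul : ∀ m n, motive (tmul A m n))
    (add : ∀ x y, motive x → motive y → motive (x + y)) : motive x := by
  induction x using QuotientAddGroup.induction_on with
  | H z =>
    induction z using TensorProduct.induction_on with
    | zero => exact zero
    | tmul m n => exact tmul m n
    | add x y hx hy => exact add _ _ hx hy

/-- The universal property: a biadditive balanced map induces an additive map on `M ⊗_A N`. -/
def lift (f : M → N → P) (h₁ : ∀ m m' n, f (m + m') n = f m n + f m' n)
    (h₂ : ∀ m n n', f m (n + n') = f m n + f m n')
    (h₃ : ∀ (a : A) m n, f (op a • m) n = f m (a • n)) : Tens A M N →+ P :=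
  QuotientAddGroup.lift (balancedRel A M N)
    (TensorProduct.liftAddHom (R := ℤ)
      (AddMonoidHom.mk' (fun m => AddMonoidHom.mk' (f m) (h₂ m))
        (fun m m' => AddMonoidHom.ext (h₁ m m')))
      (fun r m n => by
        change f (r • m) n = f m (r • n)
        have e₁ : f (r • m) n = r • f m n :=
          map_zsmul (AddMonoidHom.mk' (fun m => f m n) (fun m m' => h₁ m m' n)) r m
        have e₂ : f m (r • n) = r • f m n := map_zsmul (AddMonoidHom.mk' (f m) (h₂ m)) r n
        rw [e₁, e₂]))
    (by
      rw [balancedRel, AddSubgroup.closure_le]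
      rintro _ ⟨m, a, n, rfl⟩
      simp [AddMonoidHom.mem_ker, h₃])

@[simp] theorem lift_tmul (f : M → N → P) (h₁ h₂ h₃) (m : M) (n : N) :
    lift (A := A) f h₁ h₂ h₃ (tmul A m n) = f m n := rfl

theorem hom_ext {f g : Tens A M N →+ P} (h : ∀ m n, f (tmul A m n) = g (tmul A m n)) :
    f = g := by
  ext x
  induction x using induction_on with
  | zero => simp
  | tmul m n => exact h m n
  | add x y hx hy => simp [hx, hy]

/-- `f ⊗_A g`. -/
def map (f : M →ₗ[Aᵐᵒᵖ] M') (g : N →ₗ[A] N') : Tens A M N →+ Tens A M' N' :=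
  lift (fun m n => tmul A (f m) (g n)) (fun m m' n => by simp [add_tmul])
    (fun m n n' => by simp [tmul_add]) (fun a m n => by simp [smul_tmul])

@[simp] theorem map_tmul (f : M →ₗ[Aᵐᵒᵖ] M') (g : N →ₗ[A] N') (m : M) (n : N) :
    map f g (tmul A m n) = tmul A (f m) (g n) := rfl

theorem map_id (x : Tens A M N) : map (A := A) (LinearMap.id : M →ₗ[Aᵐᵒᵖ] M)
    (LinearMap.id : N →ₗ[A] N) x = x := by
  induction x using induction_on with
  | zero => simp
  | tmul m n => rfl
  | add x y hx hy => rw [map_add, hx, hy]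

theorem map_map (f : M →ₗ[Aᵐᵒᵖ] M') (g : N →ₗ[A] N') (f' : M' →ₗ[Aᵐᵒᵖ] M'')
    (g' : N' →ₗ[A] N'') (x : Tens A M N) :
    map f' g' (map f g x) = map (f' ∘ₗ f) (g' ∘ₗ g) x := by
  induction x using induction_on with
  | zero => simp
  | tmul m n => rfl
  | add x y hx hy => simp only [map_add, hx, hy]

theorem map_add_left (f f' : M →ₗ[Aᵐᵒᵖ] M') (g : N →ₗ[A] N') (x : Tens A M N) :
    map (f + f') g x = map f g x + map f' g x := by
  induction x using induction_on with
  | zero => simp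
  | tmul m n => simp [add_tmul]
  | add x y hx hy => simp only [map_add, hx, hy]; abel

theorem map_zero_left (g : N →ₗ[A] N') (x : Tens A M N) :
    map (0 : M →ₗ[Aᵐᵒᵖ] M') g x = 0 := by
  have h := map_add_left (0 : M →ₗ[Aᵐᵒᵖ] M') 0 g x
  rw [add_zero] at h
  exact left_eq_add.1 h

theorem map_neg_left (f : M →ₗ[Aᵐᵒᵖ] M') (g : N →ₗ[A] N') (x : Tens A M N) :
    map (-f) g x = - map f g x := by
  rw [eq_neg_iff_add_eq_zero, ← map_add_left, neg_add_cancel, map_zero_left]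

section Left
variable {T : Type*} [Ring T] [Module T M] [SMulCommClass T Aᵐᵒᵖ M]

/-- If `M` is a `(T, A)`-bimodule, then `M ⊗_A N` is a left `T`-module. -/
instance leftModule : Module T (Tens A M N) where
  smul t := lift (fun m n => tmul A (t • m) n) (fun m m' n => by simp [add_tmul])
    (fun m n n' => by simp [tmul_add]) (fun a m n => by rw [smul_comm, smul_tmul])
  one_smul x := by
    change lift _ _ _ _ x = x
    induction x using induction_on with
    | zero => simp
    | tmul m n => simp
    | add x y hx hy => rw [map_add, hx, hy]
  mul_smul s t x := by
    change lift _ _ _ _ x = lift _ _ _ _ (lift _ _ _ _ x)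
    induction x using induction_on with
    | zero => simp
    | tmul m n => simp [mul_smul]
    | add x y hx hy => rw [map_add, map_add, map_add, hx, hy]
  smul_zero t := map_zero (lift _ _ _ _)
  smul_add t x y := map_add (lift _ _ _ _) x y
  add_smul s t x := by
    change lift _ _ _ _ x = lift _ _ _ _ x + lift _ _ _ _ x
    induction x using induction_on with
    | zero => simp
    | tmul m n => simp [add_smul, add_tmul]
    | add x y hx hy => rw [map_add, map_add, map_add, hx, hy]; abel
  zero_smul x := by
    change lift _ _ _ _ x = 0
    induction x using induction_on with
    | zero => simp
    | tmul m n => rw [lift_tmul, zero_smul]; simpa using (add_tmul (A := A) (0 : M) 0 n)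
    | add x y hx hy => rw [map_add, hx, hy, add_zero]

@[simp] theorem left_smul_tmul (t : T) (m : M) (n : N) :
    t • tmul A m n = tmul A (t • m) n := rfl

theorem map_eq_smul (t : T) (f : M →ₗ[Aᵐᵒᵖ] M) (hf : ∀ m, f m = t • m) (x : Tens A M N) :
    map f (LinearMap.id (R := A)) x = t • x := by
  induction x using induction_on with
  | zero => simp
  | tmul m n => simp [hf]
  | add x y hx hy => rw [map_add, smul_add, hx, hy]
end Left

section Right
variable {S : Type*} [Ring S] [Module Sᵐᵒᵖ N] [SMulCommClass A Sᵐᵒᵖ N]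

/-- If `N` is an `(A, S)`-bimodule, then `M ⊗_A N` is a right `S`-module. -/
instance rightModule : Module Sᵐᵒᵖ (Tens A M N) where
  smul t := lift (fun m n => tmul A m (t • n)) (fun m m' n => by simp [add_tmul])
    (fun m n n' => by simp [tmul_add]) (fun a m n => by rw [smul_tmul, smul_comm])
  one_smul x := by
    change lift _ _ _ _ x = x
    induction x using induction_on with
    | zero => simp
    | tmul m n => simp
    | add x y hx hy => rw [map_add, hx, hy]
  mul_smul s t x := by
    change lift _ _ _ _ x = lift _ _ _ _ (lift _ _ _ _ x)
    induction x using induction_on with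
    | zero => simp
    | tmul m n => simp [mul_smul]
    | add x y hx hy => rw [map_add, map_add, map_add, hx, hy]
  smul_zero t := map_zero (lift _ _ _ _)
  smul_add t x y := map_add (lift _ _ _ _) x y
  add_smul s t x := by
    change lift _ _ _ _ x = lift _ _ _ _ x + lift _ _ _ _ x
    induction x using induction_on with
    | zero => simp
    | tmul m n => simp [add_smul, tmul_add]
    | add x y hx hy => rw [map_add, map_add, map_add, hx, hy]; abel
  zero_smul x := by
    change lift _ _ _ _ x = 0
    induction x using induction_on with
    | zero => simp
    | tmul m n => rw [lift_tmul, zero_smul]; simpa using (tmul_add (A := A) m (0 : N) 0)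
    | add x y hx hy => rw [map_add, hx, hy, add_zero]

@[simp] theorem right_smul_tmul (s : Sᵐᵒᵖ) (m : M) (n : N) :
    s • tmul A m n = tmul A m (s • n) := rfl
end Right

/-- If `M` is a `(T, A)`-bimodule and `N` is an `(A, S)`-bimodule, then `M ⊗_A N` is a
`(T, S)`-bimodule. -/
instance {T : Type*} [Ring T] [Module T M] [SMulCommClass T Aᵐᵒᵖ M]
    {S : Type*} [Ring S] [Module Sᵐᵒᵖ N] [SMulCommClass A Sᵐᵒᵖ N] :
    SMulCommClass T Sᵐᵒᵖ (Tens A M N) where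
  smul_comm t s x := by
    induction x using induction_on with
    | zero => simp only [smul_zero]
    | tmul m n => rfl
    | add x y hx hy => simp only [smul_add, hx, hy]

section Assoc
variable {B : Type*} [Ring B] [Module Bᵐᵒᵖ N] [SMulCommClass A Bᵐᵒᵖ N]
  {L : Type*} [AddCommGroup L] [Module B L]

/-- The canonical map `(M ⊗_A N) ⊗_B L → M ⊗_A (N ⊗_B L)`. -/
def assocHom : Tens B (Tens A M N) L →+ Tens A M (Tens B N L) :=
  lift (fun x l => lift (A := A) (fun m n => tmul A m (tmul B n l))
      (fun m m' n => by simp [add_tmul]) (fun m n n' => by simp [tmul_add, add_tmul])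
      (fun a m n => by rw [smul_tmul, left_smul_tmul]) x)
    (fun x y l => map_add _ _ _)
    (fun x l l' => by
      induction x using induction_on with
      | zero => simp
      | tmul m n => simp [tmul_add]
      | add x y hx hy => rw [map_add, map_add, map_add, hx, hy]; abel)
    (fun b x l => by
      induction x using induction_on with
      | zero => simp
      | tmul m n => simp [smul_tmul]
      | add x y hx hy => rw [smul_add, map_add, map_add, hx, hy])

/-- The canonical map `M ⊗_A (N ⊗_B L) → (M ⊗_A N) ⊗_B L`. -/
def assocInv : Tens A M (Tens B N L) →+ Tens B (Tens A M N) L :=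
  lift (fun m x => lift (A := B) (fun n l => tmul B (tmul A m n) l)
      (fun m m' n => by simp [tmul_add, add_tmul]) (fun m n n' => by simp [tmul_add])
      (fun b n l => by rw [← right_smul_tmul, smul_tmul]) x)
    (fun m m' x => by
      induction x using induction_on with
      | zero => simp
      | tmul n l => simp [add_tmul]
      | add x y hx hy => rw [map_add, map_add, map_add, hx, hy]; abel)
    (fun m x y => map_add _ _ _)
    (fun a m x => by
      induction x using induction_on with
      | zero => simp
      | tmul n l => simp [smul_tmul]
      | add x y hx hy => rw [smul_add, map_add, map_add, hx, hy])

/-- The associativity isomorphism `(M ⊗_A N) ⊗_B L ≃ M ⊗_A (N ⊗_B L)`. -/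
def assoc : Tens B (Tens A M N) L ≃+ Tens A M (Tens B N L) where
  toFun := assocHom
  invFun := assocInv
  left_inv x := by
    induction x using induction_on with
    | zero => simp
    | tmul x l =>
      induction x using induction_on with
      | zero =>
        have : tmul B (0 : Tens A M N) l = 0 := by
          simpa using (add_tmul (A := B) (0 : Tens A M N) 0 l)
        simp [this]
      | tmul m n => rfl
      | add x y hx hy => rw [add_tmul, map_add, map_add, hx, hy]
    | add x y hx hy => rw [map_add, map_add, hx, hy]
  right_inv x := by
    induction x using induction_on with
    | zero => simp
    | tmul m x =>
      induction x using induction_on with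
      | zero =>
        have : tmul A m (0 : Tens B N L) = 0 := by
          simpa using (tmul_add (A := A) m (0 : Tens B N L) 0)
        simp [this]
      | tmul m n => rfl
      | add x y hx hy => rw [tmul_add, map_add, map_add, hx, hy]
    | add x y hx hy => rw [map_add, map_add, hx, hy]
  map_add' := map_add assocHom

@[simp] theorem assoc_tmul (m : M) (n : N) (l : L) :
    assoc (tmul B (tmul A m n) l) = tmul A m (tmul B n l) := rfl

@[simp] theorem assoc_symm_tmul (m : M) (n : N) (l : L) :
    assoc.symm (tmul A m (tmul B n l)) = tmul B (tmul A m n) l := rfl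

end Assoc

@[simp] theorem zero_tmul (n : N) : tmul A (0 : M) n = 0 := by
  simpa using (add_tmul (A := A) (0 : M) 0 n)

@[simp] theorem tmul_zero (m : M) : tmul A m (0 : N) = 0 := by
  simpa using (tmul_add (A := A) m (0 : N) 0)

theorem sub_tmul (m m' : M) (n : N) : tmul A (m - m') n = tmul A m n - tmul A m' n := by
  rw [eq_sub_iff_add_eq, ← add_tmul, sub_add_cancel]

/-- The associativity isomorphism, as a homomorphism of right modules. -/
def assocRight {B : Type*} [Ring B] [Module Bᵐᵒᵖ N] [SMulCommClass A Bᵐᵒᵖ N]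
    {L : Type*} [AddCommGroup L] [Module B L] {S : Type*} [Ring S] [Module Sᵐᵒᵖ L]
    [SMulCommClass B Sᵐᵒᵖ L] : Tens B (Tens A M N) L →ₗ[Sᵐᵒᵖ] Tens A M (Tens B N L) where
  toFun := assoc
  map_add' := map_add assoc
  map_smul' s x := by
    induction x using induction_on with
    | zero => simp
    | tmul x l =>
      induction x using induction_on with
      | zero => simp
      | tmul m n => rfl
      | add x y hx hy =>
        simp only [right_smul_tmul, add_tmul, map_add, RingHom.id_apply, smul_add] at hx hy ⊢
        rw [hx, hy]
    | add x y hx hy => simp only [smul_add, map_add, hx, hy]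

/-- The canonical map `A ⊗_A N → N`, `a ⊗ n ↦ a n` (an isomorphism). -/
def lid : Tens A A N →+ N :=
  lift (fun a n => a • n) (fun _ _ _ => add_smul _ _ _) (fun _ _ _ => smul_add _ _ _)
    (fun a b n => by simp [mul_smul])

@[simp] theorem lid_tmul (a : A) (n : N) : lid (tmul A a n) = a • n := rfl

/-- The canonical map `M ⊗_A A → M`, `m ⊗ a ↦ m a` (an isomorphism). -/
def rid : Tens A M A →+ M :=
  lift (fun m a => op a • m) (fun _ _ _ => smul_add _ _ _)
    (fun _ _ _ => by rw [MulOpposite.op_add, add_smul])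
    (fun a m b => by simp [mul_smul])

@[simp] theorem rid_tmul (m : M) (a : A) : rid (tmul A m a) = op a • m := rfl

end Tens

/-- A homomorphism of `(T, S)`-bimodules. -/
structure BimodHom (T S M N : Type*) [Ring T] [Ring S] [AddCommGroup M] [AddCommGroup N]
    [Module T M] [Module T N] [Module Sᵐᵒᵖ M] [Module Sᵐᵒᵖ N] where
  /-- the map, as a homomorphism of left modules -/
  left : M →ₗ[T] N
  map_right_smul : ∀ (s : S) (m : M), left (op s • m) = op s • left m

namespace BimodHom

variable {T S M N : Type*} [Ring T] [Ring S] [AddCommGroup M] [AddCommGroup N]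
    [Module T M] [Module T N] [Module Sᵐᵒᵖ M] [Module Sᵐᵒᵖ N]

/-- The map, as a homomorphism of right modules. -/
def right (f : BimodHom T S M N) : M →ₗ[Sᵐᵒᵖ] N where
  toFun := f.left
  map_add' := f.left.map_add
  map_smul' s m := f.map_right_smul s.unop m

instance : CoeFun (BimodHom T S M N) (fun _ => M → N) := ⟨fun f => f.left⟩

@[simp] theorem right_apply (f : BimodHom T S M N) (m : M) : f.right m = f m := rfl

end BimodHom

end Tensor

/-! ### Corings and comodules -/

section Comodules

variable {k : Type u} [CommRing k]

/-- A coring over the `k`-algebra `A`: a `k`-central `A`-bimodule with a coassociative and counital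
comultiplication by bimodule maps. -/
structure Coring (k A : Type u) [CommRing k] [Ring A] [Algebra k A] where
  carrier : Type u
  [instAddCommGroup : AddCommGroup carrier]
  [instLeft : Module A carrier]
  [instRight : Module Aᵐᵒᵖ carrier]
  [instComm : SMulCommClass A Aᵐᵒᵖ carrier]
  central : ∀ (r : k) (c : carrier), algebraMap k A r • c = op (algebraMap k A r) • c
  comul : BimodHom A A carrier (Tens A carrier carrier)
  counit : BimodHom A A carrier A
  coassoc : ∀ c, Tens.assoc (Tens.map comul.right (LinearMap.id (R := A)) (comul c)) =
    Tens.map (LinearMap.id (R := Aᵐᵒᵖ)) comul.left (comul c)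
  counit_left : ∀ c, Tens.lid (Tens.map counit.right (LinearMap.id (R := A)) (comul c)) = c
  counit_right : ∀ c, Tens.rid (Tens.map (LinearMap.id (R := Aᵐᵒᵖ)) counit.left (comul c)) = c

namespace Coring
variable {A : Type u} [Ring A] [Algebra k A]
instance : CoeSort (Coring k A) (Type u) := ⟨Coring.carrier⟩
attribute [instance] instAddCommGroup instLeft instRight instComm
end Coring

variable {A : Type u} [Ring A] [Algebra k A]

/-- A right comodule over the coring `C`. -/
structure RComod (C : Coring k A) where
  carrier : Type u
  [instAddCommGroup : AddCommGroup carrier]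
  [instRight : Module Aᵐᵒᵖ carrier]
  coact : carrier →ₗ[Aᵐᵒᵖ] Tens A carrier C
  coassoc : ∀ m, Tens.assoc (Tens.map coact (LinearMap.id (R := A)) (coact m)) =
    Tens.map (LinearMap.id (R := Aᵐᵒᵖ)) C.comul.left (coact m)
  counit : ∀ m, Tens.rid (Tens.map (LinearMap.id (R := Aᵐᵒᵖ)) C.counit.left (coact m)) = m

namespace RComod

variable {C : Coring k A}

instance : CoeSort (RComod C) (Type u) := ⟨RComod.carrier⟩
attribute [instance] instAddCommGroup instRight

/-- A morphism of right comodules. -/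
@[ext] structure Hom (M N : RComod C) where
  lin : M →ₗ[Aᵐᵒᵖ] N
  comm : ∀ m, Tens.map lin (LinearMap.id (R := A)) (M.coact m) = N.coact (lin m)

/-- The category of right `C`-comodules. -/
instance : Category (RComod C) where
  Hom := Hom
  id M := ⟨LinearMap.id, fun m => Tens.map_id _⟩
  comp f g := ⟨g.lin ∘ₗ f.lin, fun m => by
    rw [LinearMap.comp_apply, ← g.comm, ← f.comm, Tens.map_map, LinearMap.id_comp]⟩

theorem hom_ext {M N : RComod C} {f g : M ⟶ N} (h : ∀ m, f.lin m = g.lin m) : f = g :=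
  Hom.ext (LinearMap.ext h)

@[simp] theorem id_lin (M : RComod C) : Hom.lin (𝟙 M) = LinearMap.id := rfl
@[simp] theorem comp_lin {M N P : RComod C} (f : M ⟶ N) (g : N ⟶ P) :
    (f ≫ g).lin = g.lin ∘ₗ f.lin := rfl

instance (M N : RComod C) : Zero (M ⟶ N) :=
  ⟨⟨0, fun m => by rw [Tens.map_zero_left]; simp⟩⟩
instance (M N : RComod C) : Add (M ⟶ N) :=
  ⟨fun f g => ⟨f.lin + g.lin, fun m => by
    rw [Tens.map_add_left, f.comm, g.comm, LinearMap.add_apply, map_add]⟩⟩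
instance (M N : RComod C) : Neg (M ⟶ N) :=
  ⟨fun f => ⟨-f.lin, fun m => by
    rw [Tens.map_neg_left, f.comm, LinearMap.neg_apply, map_neg]⟩⟩

@[simp] theorem zero_lin (M N : RComod C) : Hom.lin (0 : M ⟶ N) = 0 := rfl
@[simp] theorem add_lin {M N : RComod C} (f g : M ⟶ N) : (f + g).lin = f.lin + g.lin := rfl
@[simp] theorem neg_lin {M N : RComod C} (f : M ⟶ N) : (-f).lin = -f.lin := rfl

instance (M N : RComod C) : AddCommGroup (M ⟶ N) where
  add_assoc f g h := hom_ext fun m => by simp [add_assoc]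
  zero_add f := hom_ext fun m => by simp
  add_zero f := hom_ext fun m => by simp
  add_comm f g := hom_ext fun m => by simp [add_comm]
  neg_add_cancel f := hom_ext fun m => by simp
  nsmul := nsmulRec
  zsmul := zsmulRec

@[simp] theorem sub_lin {M N : RComod C} (f g : M ⟶ N) : (f - g).lin = f.lin - g.lin := by
  rw [sub_eq_add_neg, add_lin, neg_lin, sub_eq_add_neg]

instance : Preadditive (RComod C) where
  add_comp M N P f g h := hom_ext fun m => by simp
  comp_add M N P f g h := hom_ext fun m => by simp

/-- Every right module over the `k`-algebra `A` is a `k`-module by `r m = m · r`; this is the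
induced endomorphism of a comodule. -/
def scalar (r : k) (M : RComod C) : M ⟶ M where
  lin :=
    { toFun := fun m => op (algebraMap k A r) • m
      map_add' := fun m n => smul_add _ _ _
      map_smul' := fun a m => by
        simp only [RingHom.id_apply, ← mul_smul]
        congr 1
        exact congrArg op (Algebra.commutes r a.unop).symm }
  comm m := by
    have key : ∀ x : Tens A M C, Tens.map (A := A)
        { toFun := fun m : M => op (algebraMap k A r) • m
          map_add' := fun m n => smul_add _ _ _
          map_smul' := fun a m => by
            simp only [RingHom.id_apply, ← mul_smul]
            congr 1
            exact congrArg op (Algebra.commutes r a.unop).symm }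
        (LinearMap.id (R := A)) x = op (algebraMap k A r) • x := by
      intro x
      induction x using Tens.induction_on with
      | zero => simp
      | tmul m c =>
        rw [Tens.map_tmul, Tens.right_smul_tmul, ← C.central, ← Tens.smul_tmul]; rfl
      | add x y hx hy => rw [map_add, smul_add, hx, hy]
    rw [key]
    exact (map_smul M.coact _ _).symm

/-- The `k`-module structure on the set of comodule morphisms: `(r f)(m) = f(m) · r`. -/
instance (M N : RComod C) : Module k (M ⟶ N) where
  smul r f := f ≫ scalar r N
  one_smul f := hom_ext fun m => by
    change op (algebraMap k A 1) • f.lin m = f.lin m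
    simp
  mul_smul r s f := hom_ext fun m => by
    change op (algebraMap k A (r * s)) • f.lin m
      = op (algebraMap k A r) • op (algebraMap k A s) • f.lin m
    rw [← mul_smul, ← op_mul, ← map_mul, mul_comm]
  smul_zero r := hom_ext fun m => by
    change op (algebraMap k A r) • (0 : N) = 0
    simp
  smul_add r f g := hom_ext fun m => by
    change op (algebraMap k A r) • (f.lin m + g.lin m) = _
    rw [smul_add]; rfl
  add_smul r s f := hom_ext fun m => by
    change op (algebraMap k A (r + s)) • f.lin m = _
    rw [map_add, MulOpposite.op_add, add_smul]; rfl
  zero_smul f := hom_ext fun m => by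
    change op (algebraMap k A 0) • f.lin m = 0
    simp

@[simp] theorem smul_lin {M N : RComod C} (r : k) (f : M ⟶ N) (m : M) :
    (r • f).lin m = op (algebraMap k A r) • f.lin m := rfl

instance : Linear k (RComod C) where
  smul_comp M N P r f g := hom_ext fun m => by simp
  comp_smul M N P f r g := hom_ext fun m => by simp

end RComod

/-! ### Left objects in the category of comodules, and `X ⊗_T -` -/

/-- A right comodule with a compatible left action of the `k`-algebra `T`: a left `T`-object in the
category of right `C`-comodules. -/
structure LRComod (T : Type u) [Ring T] [Algebra k T] (C : Coring k A) extends RComod C where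
  [instLeft : Module T carrier]
  [instComm : SMulCommClass T Aᵐᵒᵖ carrier]
  central : ∀ (r : k) (m : carrier), algebraMap k T r • m = op (algebraMap k A r) • m
  coact_smul : ∀ (t : T) (m : carrier), coact (t • m) = t • coact m

namespace LRComod

variable {T : Type u} [Ring T] [Algebra k T] {C : Coring k A}

instance : CoeSort (LRComod T C) (Type u) := ⟨fun M => M.carrier⟩
attribute [instance] instLeft instComm

/-- The coaction as a bimodule map. -/
def coactBi (M : LRComod T C) : BimodHom T A M (Tens A M C) where
  left :=
    { toFun := M.coact
      map_add' := map_add M.coact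
      map_smul' := M.coact_smul }
  map_right_smul s m := map_smul M.coact (op s) m

@[simp] theorem coactBi_apply (M : LRComod T C) (m : M) : M.coactBi m = M.coact m := rfl
@[simp] theorem coactBi_left (M : LRComod T C) (m : M) : M.coactBi.left m = M.coact m := rfl

/-- The action of `t ∈ T` as an endomorphism of the comodule `M`. -/
def act (M : LRComod T C) (t : T) : M.toRComod ⟶ M.toRComod where
  lin :=
    { toFun := fun m => t • m
      map_add' := smul_add t
      map_smul' := fun a m => smul_comm t a m }
  comm m := by
    have key : ∀ x : Tens A M C, Tens.map (A := A)
        { toFun := fun m : M => t • m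
          map_add' := smul_add t
          map_smul' := fun a m => smul_comm t a m }
        (LinearMap.id (R := A)) x = t • x := by
      intro x
      induction x using Tens.induction_on with
      | zero => simp
      | tmul m c => rfl
      | add x y hx hy => rw [map_add, smul_add, hx, hy]
    rw [key]
    exact (M.coact_smul t m).symm

@[simp] theorem act_lin (M : LRComod T C) (t : T) (m : M) : (M.act t).lin m = t • m := rfl

section TensObj

variable (X : Type u) [AddCommGroup X] [Module Tᵐᵒᵖ X] (M : LRComod T C)

/-- The coaction `X ⊗ ρ_M` of the comodule `X ⊗_T M`. -/
def tensCoact : Tens T X M →ₗ[Aᵐᵒᵖ] Tens A (Tens T X M) C where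
  toFun x := Tens.assoc.symm (Tens.map (LinearMap.id (R := Tᵐᵒᵖ)) M.coactBi.left x)
  map_add' x y := by simp
  map_smul' a x := by
    induction x using Tens.induction_on with
    | zero => simp
    | tmul x m =>
      simp only [Tens.right_smul_tmul, Tens.map_tmul, LinearMap.id_apply, RingHom.id_apply,
        coactBi_left, map_smul]
      induction M.coact m using Tens.induction_on with
      | zero => simp
      | tmul m c => rfl
      | add x y hx hy => simp only [smul_add, Tens.tmul_add, map_add, hx, hy]
    | add x y hx hy => simp only [smul_add, map_add, hx, hy]

theorem tensCoact_tmul (x : X) (m : M) :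
    tensCoact X M (Tens.tmul T x m) = Tens.assoc.symm (Tens.tmul T x (M.coact m)) := rfl

/-- The comodule `X ⊗_T M`, for a right `T`-module `X` and a left `T`-object `M`. -/
def tens : RComod C where
  carrier := Tens T X M
  coact := tensCoact X M
  coassoc z := by
    induction z using Tens.induction_on with
    | zero => simp
    | tmul x m =>
      have h₁ : ∀ w : Tens A M C,
          Tens.assoc (Tens.map (tensCoact X M) (LinearMap.id (R := A))
            (Tens.assoc.symm (Tens.tmul T x w))) =
          Tens.assoc.symm (Tens.tmul T x
            (Tens.assoc (Tens.map M.coact (LinearMap.id (R := A)) w))) := by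
        intro w
        induction w using Tens.induction_on with
        | zero => simp
        | tmul m c =>
          simp only [Tens.assoc_symm_tmul, Tens.map_tmul, tensCoact_tmul, LinearMap.id_apply]
          induction M.coact m using Tens.induction_on with
          | zero => simp
          | tmul m c => rfl
          | add x y hx hy => simp only [Tens.tmul_add, Tens.add_tmul, map_add, hx, hy]
        | add x y hx hy => simp only [Tens.tmul_add, map_add, hx, hy]
      have h₂ : ∀ w : Tens A M C,
          Tens.map (LinearMap.id (R := Aᵐᵒᵖ)) C.comul.left
            (Tens.assoc.symm (Tens.tmul T x w)) =
          Tens.assoc.symm (Tens.tmul T x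
            (Tens.map (LinearMap.id (R := Aᵐᵒᵖ)) C.comul.left w)) := by
        intro w
        induction w using Tens.induction_on with
        | zero => simp
        | tmul m c => rfl
        | add x y hx hy => simp only [Tens.tmul_add, map_add, hx, hy]
      rw [tensCoact_tmul, h₁, h₂, M.coassoc]
    | add x y hx hy => simp only [map_add, hx, hy]
  counit z := by
    induction z using Tens.induction_on with
    | zero => simp
    | tmul x m =>
      have h : ∀ w : Tens A M C,
          Tens.rid (Tens.map (LinearMap.id (R := Aᵐᵒᵖ)) C.counit.left
            (Tens.assoc.symm (Tens.tmul T x w))) =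
          Tens.tmul T x
            (Tens.rid (Tens.map (LinearMap.id (R := Aᵐᵒᵖ)) C.counit.left w)) := by
        intro w
        induction w using Tens.induction_on with
        | zero => simp
        | tmul m c => rfl
        | add x y hx hy => simp only [Tens.tmul_add, map_add, hx, hy]
      rw [tensCoact_tmul, h, M.counit]
    | add x y hx hy => simp only [map_add, hx, hy]

/-- The comodule morphism `x ⊗ - : M → X ⊗_T M`. -/
def insert (x : X) : M.toRComod ⟶ M.tens X where
  lin :=
    { toFun := fun m => Tens.tmul T x m
      map_add' := Tens.tmul_add x
      map_smul' := fun a m => rfl }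
  comm m := by
    have key : ∀ (f : M →ₗ[Aᵐᵒᵖ] Tens T X M) (_ : ∀ m, f m = Tens.tmul T x m) (w : Tens A M C),
        Tens.map f (LinearMap.id (R := A)) w = Tens.assoc.symm (Tens.tmul T x w) := by
      intro f hf w
      induction w using Tens.induction_on with
      | zero => simp
      | tmul m c => rw [Tens.map_tmul, hf]; rfl
      | add x y hx hy => simp only [Tens.tmul_add, map_add, hx, hy]
    exact key _ (fun _ => rfl) _

@[simp] theorem insert_lin (x : X) (m : M) :
    (M.insert X x).lin m = Tens.tmul T x m := rfl

variable {X M} in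
theorem tens_hom_ext {N : RComod C} {f g : M.tens X ⟶ N}
    (h : ∀ (x : X) (m : M), f.lin (Tens.tmul T x m) = g.lin (Tens.tmul T x m)) : f = g := by
  have e : (f.lin.toAddMonoidHom : Tens T X M →+ N) = g.lin.toAddMonoidHom := Tens.hom_ext h
  exact RComod.hom_ext fun z => DFunLike.congr_fun e z

/-- A morphism out of `X ⊗_T M` from an additive map that is compatible with the right actions and
the coactions on pure tensors. -/
def tensDesc (N : RComod C) (f : Tens T X M →+ N)
    (h₁ : ∀ (a : Aᵐᵒᵖ) (x : X) (m : M), f (Tens.tmul T x (a • m)) = a • f (Tens.tmul T x m))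
    (h₂ : ∀ (L : Tens T X M →ₗ[Aᵐᵒᵖ] N) (_ : ∀ z, L z = f z) (x : X) (m : M),
      Tens.map L (LinearMap.id (R := A)) (Tens.assoc.symm (Tens.tmul T x (M.coact m))) =
        N.coact (f (Tens.tmul T x m))) : M.tens X ⟶ N :=
  let L : Tens T X M →ₗ[Aᵐᵒᵖ] N :=
    { toFun := f
      map_add' := map_add f
      map_smul' := fun a z => by
        induction z using Tens.induction_on with
        | zero => simp
        | tmul x m => exact h₁ a x m
        | add x y hx hy => simp only [smul_add, map_add, hx, hy] }
  have key : ∀ z : Tens T X M,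
      Tens.map L (LinearMap.id (R := A)) (tensCoact X M z) = N.coact (L z) := fun z => by
    induction z using Tens.induction_on with
    | zero => simp
    | tmul x m => exact h₂ L (fun _ => rfl) x m
    | add x y hx hy => simp only [map_add, hx, hy]
  { lin := L, comm := key }

@[simp] theorem tensDesc_lin (N : RComod C) (f : Tens T X M →+ N) (h₁ h₂) (z : Tens T X M) :
    (tensDesc X M N f h₁ h₂).lin z = f z := rfl

variable {X} in
/-- The comodule morphism `f ⊗ M : X ⊗_T M → Y ⊗_T M`. -/
def tensMap {Y : Type u} [AddCommGroup Y] [Module Tᵐᵒᵖ Y] (f : X →ₗ[Tᵐᵒᵖ] Y) :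
    M.tens X ⟶ M.tens Y :=
  tensDesc X M (M.tens Y) (Tens.map f (LinearMap.id (R := T)) : Tens T X M →+ Tens T Y M)
    (fun _ _ _ => rfl)
    (fun L hL x m => by
      have key : ∀ (L : Tens T X M →ₗ[Aᵐᵒᵖ] Tens T Y M)
          (_ : ∀ z, L z = Tens.map f (LinearMap.id (R := T)) z) (w : Tens A M C),
          Tens.map L (LinearMap.id (R := A)) (Tens.assoc.symm (Tens.tmul T x w)) =
            Tens.assoc.symm (Tens.tmul T (f x) w) := by
        intro L hL w
        induction w using Tens.induction_on with
        | zero => simp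
        | tmul m c => rw [Tens.assoc_symm_tmul, Tens.map_tmul, hL]; rfl
        | add x y hx hy => simp only [Tens.tmul_add, map_add, hx, hy]
      exact key L hL _)

@[simp] theorem tensMap_tmul {Y : Type u} [AddCommGroup Y] [Module Tᵐᵒᵖ Y]
    (f : X →ₗ[Tᵐᵒᵖ] Y) (x : X) (m : M) :
    (M.tensMap f).lin (Tens.tmul T x m) = Tens.tmul T (f x) m := rfl

/-- The canonical isomorphism `T ⊗_T M → M`, as a comodule morphism. -/
def unitHom : M.tens T ⟶ M.toRComod :=
  tensDesc T M M.toRComod (Tens.lid : Tens T T M →+ M)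
    (fun a t m => smul_comm t a m)
    (fun L hL t m => by
      rw [Tens.lid_tmul, M.coact_smul]
      induction M.coact m using Tens.induction_on with
      | zero => simp
      | tmul m c => rw [Tens.assoc_symm_tmul, Tens.map_tmul, hL]; rfl
      | add x y hx hy => simp only [Tens.tmul_add, smul_add, map_add, hx, hy])

@[simp] theorem unitHom_tmul (t : T) (m : M) : M.unitHom.lin (Tens.tmul T t m) = t • m := rfl

end TensObj

end LRComod

/-! ### The action of a `k`-linear functor and the transformation `Υ` -/

section Functor

variable {B : Type u} [Ring B] [Algebra k B] {T : Type u} [Ring T] [Algebra k T]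
variable {C : Coring k A} {D : Coring k B}
variable (F : RComod C ⥤ RComod D) [F.Additive]

/-- For a left `T`-object `M`, the left `T`-module structure of `F(M)`: `t` acts as `F(t · -)`. -/
@[reducible] def LRComod.mapModule (M : LRComod T C) : Module T (F.obj M.toRComod) :=
  { smul := fun t y => (F.map (M.act t)).lin y
    one_smul := fun y => by
      have : M.act (1 : T) = 𝟙 _ := RComod.hom_ext fun m => by simp
      change (F.map (M.act 1)).lin y = y
      rw [this, F.map_id]; rfl
    mul_smul := fun s t y => by
      have : M.act (s * t) = M.act t ≫ M.act s := RComod.hom_ext fun m => by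
        simp [mul_smul]
      change (F.map (M.act (s * t))).lin y = (F.map (M.act s)).lin ((F.map (M.act t)).lin y)
      rw [this, F.map_comp]; rfl
    smul_zero := fun t => map_zero _
    smul_add := fun t => map_add _
    add_smul := fun s t y => by
      have : M.act (s + t) = M.act s + M.act t := RComod.hom_ext fun m => by
        simp [add_smul]
      change (F.map (M.act (s + t))).lin y = (F.map (M.act s)).lin y + (F.map (M.act t)).lin y
      rw [this, F.map_add]; rfl
    zero_smul := fun y => by
      have : M.act (0 : T) = 0 := RComod.hom_ext fun m => by simp
      change (F.map (M.act 0)).lin y = 0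
      rw [this, F.map_zero]; rfl }

theorem LRComod.mapModule_comm (M : LRComod T C) :
    letI := M.mapModule F
    SMulCommClass T Bᵐᵒᵖ (F.obj M.toRComod) :=
  letI := M.mapModule F
  ⟨fun t b y => map_smul (F.map (M.act t)).lin b y⟩

variable [F.Linear k]

/-- For a left `T`-object `M`, the comodule `F(M)` with the left action `t ↦ F(t · -)`. -/
def LRComod.mapFunctor (M : LRComod T C) : LRComod T D where
  toRComod := F.obj M.toRComod
  instLeft := M.mapModule F
  instComm := M.mapModule_comm F
  central r y := by
    have : M.act (algebraMap k T r) = r • 𝟙 _ := RComod.hom_ext fun m => by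
      rw [LRComod.act_lin, M.central]; rfl
    change (F.map (M.act (algebraMap k T r))).lin y = _
    rw [this, F.map_smul, F.map_id]; rfl
  coact_smul t y := by
    let _ := M.mapModule F
    have := M.mapModule_comm F
    refine ((F.map (M.act t)).comm y).symm.trans ?_
    exact Tens.map_eq_smul t _ (fun _ => rfl) _

theorem LRComod.act_mapFunctor (M : LRComod T C) (t : T) :
    (M.mapFunctor F).act t = F.map (M.act t) := rfl

section Upsilon

variable (X : Type u) [AddCommGroup X] [Module Tᵐᵒᵖ X] (M : LRComod T C)

/-- The natural morphism `Υ_{X,M} : X ⊗_T F(M) → F(X ⊗_T M)`, `x ⊗ y ↦ F(x ⊗ -)(y)`. By the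
three lemmas that follow, it is the unique natural transformation in `X` that extends the canonical
isomorphism `T ⊗_T F(M) ≃ F(M) ≃ F(T ⊗_T M)`. -/
def upsilon : (M.mapFunctor F).tens X ⟶ F.obj (M.tens X) :=
  LRComod.tensDesc X (M.mapFunctor F) (F.obj (M.tens X))
    (Tens.lift (fun (x : X) (y : M.mapFunctor F) => (F.map (M.insert X x)).lin y)
      (fun x x' y => by
        have : M.insert X (x + x') = M.insert X x + M.insert X x' :=
          RComod.hom_ext fun m => Tens.add_tmul x x' m
        rw [this, F.map_add]; rfl)
      (fun x y y' => map_add (F.map (M.insert X x)).lin y y')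
      (fun t x y => by
        have : M.insert X (op t • x) = M.act t ≫ M.insert X x :=
          RComod.hom_ext fun m => Tens.smul_tmul t x m
        rw [this, F.map_comp]; rfl))
    (fun b x y => map_smul (F.map (M.insert X x)).lin b y)
    (fun L hL x y => by
      refine Eq.trans ?_ ((F.map (M.insert X x)).comm y)
      have key : ∀ (g : M.mapFunctor F →ₗ[Bᵐᵒᵖ] F.obj (M.tens X))
          (_ : ∀ y, g y = (F.map (M.insert X x)).lin y) (w : Tens B (M.mapFunctor F) D),
          Tens.map L (LinearMap.id (R := B)) (Tens.assoc.symm (Tens.tmul T x w)) =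
            Tens.map g (LinearMap.id (R := B)) w := by
        intro g hg w
        induction w using Tens.induction_on with
        | zero => simp
        | tmul m c => rw [Tens.assoc_symm_tmul, Tens.map_tmul, Tens.map_tmul, hL, hg]; rfl
        | add x y hx hy => simp only [Tens.tmul_add, map_add, hx, hy]
      exact key (F.map (M.insert X x)).lin (fun _ => rfl) _)

theorem upsilon_tmul (x : X) (y : M.mapFunctor F) :
    (upsilon F X M).lin (Tens.tmul T x y) = (F.map (M.insert X x)).lin y := rfl

/-- `Υ_{X,M}` is natural in `X`. -/
theorem upsilon_natural {Y : Type u} [AddCommGroup Y] [Module Tᵐᵒᵖ Y] (f : X →ₗ[Tᵐᵒᵖ] Y) :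
    (M.mapFunctor F).tensMap f ≫ upsilon F Y M = upsilon F X M ≫ F.map (M.tensMap f) := by
  refine LRComod.tens_hom_ext fun x y => ?_
  have : M.insert Y (f x) = M.insert X x ≫ M.tensMap f := RComod.hom_ext fun m => rfl
  change (F.map (M.insert Y (f x))).lin y =
    (F.map (M.tensMap f)).lin ((F.map (M.insert X x)).lin y)
  rw [this, F.map_comp]; rfl

/-- `Υ_{T,M}` is the canonical isomorphism. -/
theorem upsilon_unit : upsilon F T M ≫ F.map M.unitHom = (M.mapFunctor F).unitHom := by
  refine LRComod.tens_hom_ext fun t y => ?_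
  have : M.insert T t ≫ M.unitHom = M.act t := RComod.hom_ext fun m => rfl
  change (F.map M.unitHom).lin ((F.map (M.insert T t)).lin y) = (F.map (M.act t)).lin y
  rw [← this, F.map_comp]; rfl

/-- Uniqueness of `Υ`. -/
theorem upsilon_unique
    (η : ∀ (X : Type u) [AddCommGroup X] [Module Tᵐᵒᵖ X],
      (M.mapFunctor F).tens X ⟶ F.obj (M.tens X))
    (nat : ∀ (X Y : Type u) [AddCommGroup X] [Module Tᵐᵒᵖ X] [AddCommGroup Y] [Module Tᵐᵒᵖ Y]
      (f : X →ₗ[Tᵐᵒᵖ] Y),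
      (M.mapFunctor F).tensMap f ≫ η Y = η X ≫ F.map (M.tensMap f))
    (unit : η T ≫ F.map M.unitHom = (M.mapFunctor F).unitHom) : η X = upsilon F X M := by
  have h1 : M.unitHom ≫ M.insert T 1 = 𝟙 (M.tens T) := LRComod.tens_hom_ext fun t m => by
    change Tens.tmul T 1 (t • m) = Tens.tmul T t m
    rw [← Tens.smul_tmul]; simp
  have hT : η T = upsilon F T M := by
    have h2 := unit.trans (upsilon_unit F M).symm
    have h3 := congrArg (fun g => g ≫ F.map (M.insert T 1)) h2
    simpa only [Category.assoc, ← F.map_comp, h1, F.map_id, Category.comp_id] using h3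
  refine LRComod.tens_hom_ext fun x y => ?_
  let f : T →ₗ[Tᵐᵒᵖ] X :=
    { toFun := fun t => op t • x
      map_add' := fun s t => by rw [MulOpposite.op_add, add_smul]
      map_smul' := fun a t => by simp [mul_smul] }
  have h4 := (nat T X f).trans ((congrArg (· ≫ F.map (M.tensMap f)) hT).trans
    (upsilon_natural F T M f).symm)
  have h5 := congrArg (fun g => RComod.Hom.lin g (Tens.tmul T 1 y)) h4
  change (η X).lin (Tens.tmul T (op (1 : T) • x) y) =
    (upsilon F X M).lin (Tens.tmul T (op (1 : T) • x) y) at h5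
  simpa using h5

end Upsilon

end Functor

/-! ### Bicomodules and the cotensor product -/

section Cotensor

variable {B : Type u} [Ring B] [Algebra k B]
variable {C : Coring k A} {D : Coring k B}

variable (C) in
/-- A left coaction of `C` that makes the right `D`-comodule `M` (with its left `A`-action) a
`(C, D)`-bicomodule. -/
structure LeftCoaction (M : LRComod A D) where
  coact : BimodHom A B M (Tens A C M)
  coassoc : ∀ m, Tens.assoc (Tens.map C.comul.right (LinearMap.id (R := A)) (coact m)) =
    Tens.map (LinearMap.id (R := Aᵐᵒᵖ)) coact.left (coact m)
  counit : ∀ m, Tens.lid (Tens.map C.counit.right (LinearMap.id (R := A)) (coact m)) = m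
  compat : ∀ m, Tens.assoc (Tens.map coact.right (LinearMap.id (R := B)) (M.coact m)) =
    Tens.map (LinearMap.id (R := Aᵐᵒᵖ)) M.coactBi.left (coact m)

variable (C) in
/-- The coring `C` as a right comodule over itself with its left `A`-action. -/
def Coring.regular : LRComod A C where
  carrier := C
  coact := C.comul.right
  coassoc := C.coassoc
  counit := C.counit_right
  central := C.central
  coact_smul a c := map_smul C.comul.left a c

variable (C) in
/-- `C` is coseparable: the comultiplication has a retraction `C ⊗_A C → C` which is a map of
`(C, C)`-bicomodules. -/
def Coring.IsCoseparable : Prop :=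
  ∃ γ : BimodHom A A (Tens A C C) C,
    (∀ c, γ (C.comul c) = c) ∧
    (∀ x, C.comul (γ x) = Tens.map γ.right (LinearMap.id (R := A))
      (Tens.assoc.symm (Tens.map (LinearMap.id (R := Aᵐᵒᵖ)) C.comul.left x))) ∧
    (∀ x, C.comul (γ x) = Tens.map (LinearMap.id (R := Aᵐᵒᵖ)) γ.left
      (Tens.assoc (Tens.map C.comul.right (LinearMap.id (R := A)) x)))

namespace LeftCoaction

variable {M : LRComod A D} (lam : LeftCoaction C M) (N : RComod C)

/-- The map `ω_{N,M} = ρ_N ⊗ M - N ⊗ λ_M : N ⊗_A M → N ⊗_A C ⊗_A M`. -/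
def omega : Tens A N M →ₗ[Bᵐᵒᵖ] Tens A N (Tens A C M) where
  toFun x := Tens.assoc (Tens.map N.coact (LinearMap.id (R := A)) x) -
    Tens.map (LinearMap.id (R := Aᵐᵒᵖ)) lam.coact.left x
  map_add' x y := by simp only [map_add]; abel
  map_smul' b x := by
    induction x using Tens.induction_on with
    | zero => simp
    | tmul n m =>
      simp only [Tens.right_smul_tmul, Tens.map_tmul, LinearMap.id_apply, RingHom.id_apply,
        smul_sub]
      congr 1
      · induction N.coact n using Tens.induction_on with
        | zero => simp
        | tmul m c => rfl
        | add x y hx hy => simp only [Tens.add_tmul, smul_add, map_add, hx, hy]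
      · exact congrArg (Tens.tmul A n) (lam.coact.map_right_smul b.unop m)
    | add x y hx hy =>
      simp only [smul_add, map_add, RingHom.id_apply, smul_sub] at hx hy ⊢
      rw [add_sub_add_comm, hx, hy]; abel

/-- The cotensor product `N □_C M`, a right `B`-submodule of `N ⊗_A M`. -/
def cotensor : Submodule Bᵐᵒᵖ (Tens A N M) := LinearMap.ker (lam.omega N)

/-- The canonical injection `ι_{N,M} : N □_C M → N ⊗_A M`. -/
def incl : lam.cotensor N →ₗ[Bᵐᵒᵖ] Tens A N M := (lam.cotensor N).subtype

/-- The condition under which `- □_C M` takes its values in right `D`-comodules: for every `N`, the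
map `ω_{N,M}` is `D`-pure (its kernel is preserved by `- ⊗_B D`) and `ι_{N,M} ⊗ D ⊗ D` is
injective. -/
structure IsCotensorable : Prop where
  injective : ∀ N : RComod C,
    Function.Injective (Tens.map (lam.incl N) (LinearMap.id (R := B) (M := D)))
  exact : ∀ (N : RComod C) (x : Tens B (Tens A N M) D),
    Tens.map (lam.omega N) (LinearMap.id (R := B) (M := D)) x = 0 →
      ∃ y, Tens.map (lam.incl N) (LinearMap.id (R := B) (M := D)) y = x
  injective₂ : ∀ N : RComod C,
    Function.Injective (Tens.map (lam.incl N) (LinearMap.id (R := B) (M := Tens B D D)))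

/-- The right coaction of `C ⊗_A M`, as an `A`-linear map. -/
def coactCM (M : LRComod A D) (C : Coring k A) :
    Tens A C M →ₗ[A] Tens B (Tens A C M) D where
  toFun z := Tens.assoc.symm (Tens.map (LinearMap.id (R := Aᵐᵒᵖ)) M.coactBi.left z)
  map_add' z w := by simp only [map_add]
  map_smul' a z := by
    induction z using Tens.induction_on with
    | zero => simp
    | tmul c m =>
      simp only [Tens.left_smul_tmul, Tens.map_tmul, LinearMap.id_apply, RingHom.id_apply]
      induction M.coactBi.left m using Tens.induction_on with
      | zero => simp
      | tmul m c => rfl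
      | add x y hx hy => simp only [Tens.tmul_add, smul_add, map_add, hx, hy]
    | add x y hx hy => simp only [smul_add, map_add, hx, hy]

/-- The right coaction of `N ⊗_A (C ⊗_A M)`. -/
def coactNCM (N : RComod C) (M : LRComod A D) :
    Tens A N (Tens A C M) →+ Tens B (Tens A N (Tens A C M)) D :=
  Tens.assoc.symm.toAddMonoidHom.comp
    (Tens.map (LinearMap.id (R := Aᵐᵒᵖ)) (coactCM M C))

/-- `(N ⊗ C) ⊗ (M ⊗ D) → (N ⊗ (C ⊗ M)) ⊗ D`. -/
def shuffle (N : RComod C) (M : LRComod A D) :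
    Tens A (Tens A N C) (Tens B M D) →+ Tens B (Tens A N (Tens A C M)) D :=
  (Tens.map (Tens.assocRight (A := A) (B := A) (S := B) (M := N) (N := C) (L := M))
    (LinearMap.id (R := B) (M := D))).comp Tens.assoc.symm.toAddMonoidHom

theorem shuffle_tmul (w : Tens A N C) (m : M) (d : D) :
    shuffle N M (Tens.tmul A w (Tens.tmul B m d)) =
      Tens.tmul B (Tens.assoc (Tens.tmul A w m)) d := rfl

theorem coactNCM_assoc (w : Tens A N C) (m : M) :
    coactNCM N M (Tens.assoc (Tens.tmul A w m)) = shuffle N M (Tens.tmul A w (M.coact m)) := by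
  induction w using Tens.induction_on with
  | zero => simp
  | tmul n c =>
    change Tens.assoc.symm (Tens.tmul A n (Tens.assoc.symm (Tens.tmul A c (M.coact m)))) = _
    induction M.coact m using Tens.induction_on with
    | zero => simp
    | tmul m d => rfl
    | add x y hx hy => simp only [Tens.tmul_add, map_add, hx, hy]
  | add x y hx hy => simp only [Tens.add_tmul, map_add, hx, hy]

theorem coactNCM_lam (n : N) (m : M) :
    coactNCM N M (Tens.tmul A n (lam.coact m)) =
      Tens.assoc.symm (Tens.tmul A n
        (Tens.map lam.coact.right (LinearMap.id (R := B)) (M.coact m))) := by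
  change Tens.assoc.symm (Tens.tmul A n (Tens.assoc.symm
    (Tens.map (LinearMap.id (R := Aᵐᵒᵖ)) M.coactBi.left (lam.coact m)))) = _
  rw [← lam.compat, AddEquiv.symm_apply_apply]

theorem omega_tmul (n : N) (m : M) : lam.omega N (Tens.tmul A n m) =
    Tens.assoc (Tens.tmul A (N.coact n) m) - Tens.tmul A n (lam.coact m) := rfl

theorem map_omega_tmul (n : N) (z : Tens B M D) :
    Tens.map (lam.omega N) (LinearMap.id (R := B) (M := D))
      (Tens.assoc.symm (Tens.tmul A n z)) =
    shuffle N M (Tens.tmul A (N.coact n) z) -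
      Tens.assoc.symm (Tens.tmul A n (Tens.map lam.coact.right (LinearMap.id (R := B)) z)) := by
  induction z using Tens.induction_on with
  | zero => simp
  | tmul m d =>
    rw [Tens.assoc_symm_tmul, Tens.map_tmul, omega_tmul, Tens.sub_tmul, shuffle_tmul]
    rfl
  | add x y hx hy =>
    simp only [Tens.tmul_add, map_add, hx, hy]; abel

theorem map_omega_coact (x : Tens A N M) :
    Tens.map (lam.omega N) (LinearMap.id (R := B) (M := D)) (LRComod.tensCoact N M x) =
      coactNCM N M (lam.omega N x) := by
  induction x using Tens.induction_on with
  | zero => simp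
  | tmul n m =>
    rw [LRComod.tensCoact_tmul, map_omega_tmul, omega_tmul, map_sub, coactNCM_assoc, coactNCM_lam]
  | add x y hx hy => simp only [map_add, hx, hy]

section CotensorFunctor

variable {lam}

theorem IsCotensorable.exists_lift (h : lam.IsCotensorable) (N : RComod C) (x : lam.cotensor N) :
    ∃ y : Tens B (lam.cotensor N) D, Tens.map (lam.incl N) (LinearMap.id (R := B)) y =
      LRComod.tensCoact N M (lam.incl N x) := by
  apply h.exact
  rw [map_omega_coact]
  have : lam.omega N (lam.incl N x) = 0 := x.2
  rw [this, map_zero]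

/-- The coaction of `N □_C M`: the restriction of `N ⊗ ρ_M`. -/
noncomputable def IsCotensorable.coact (h : lam.IsCotensorable) (N : RComod C) :
    lam.cotensor N →ₗ[Bᵐᵒᵖ] Tens B (lam.cotensor N) D where
  toFun x := (h.exists_lift N x).choose
  map_add' x y := h.injective N (by
    rw [(h.exists_lift N (x + y)).choose_spec, map_add (Tens.map _ _),
      (h.exists_lift N x).choose_spec, (h.exists_lift N y).choose_spec, map_add, map_add])
  map_smul' b x := h.injective N (by
    have key : ∀ z : Tens B (lam.cotensor N) D,
        Tens.map (lam.incl N) (LinearMap.id (R := B) (M := D)) (b • z) =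
          b • Tens.map (lam.incl N) (LinearMap.id (R := B) (M := D)) z := by
      intro z
      induction z using Tens.induction_on with
      | zero => simp
      | tmul x d => rfl
      | add x y hx hy => simp only [smul_add, map_add, hx, hy]
    rw [(h.exists_lift N (b • x)).choose_spec, RingHom.id_apply, key,
      (h.exists_lift N x).choose_spec, map_smul, map_smul])

theorem IsCotensorable.incl_coact (h : lam.IsCotensorable) (N : RComod C) (x : lam.cotensor N) :
    Tens.map (lam.incl N) (LinearMap.id (R := B)) (h.coact N x) =
      LRComod.tensCoact N M (lam.incl N x) := (h.exists_lift N x).choose_spec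

theorem map_assoc {V W : Type u} [AddCommGroup V] [Module Bᵐᵒᵖ V] [AddCommGroup W]
    [Module Bᵐᵒᵖ W] (f : V →ₗ[Bᵐᵒᵖ] W) (z : Tens B (Tens B V D) D) (g : Tens B V D →ₗ[Bᵐᵒᵖ] Tens B W D)
    (hg : ∀ w, g w = Tens.map f (LinearMap.id (R := B)) w) :
    Tens.map f (LinearMap.id (R := B) (M := Tens B D D)) (Tens.assoc z) =
      Tens.assoc (Tens.map g (LinearMap.id (R := B)) z) := by
  induction z using Tens.induction_on with
  | zero => simp
  | tmul w d =>
    rw [Tens.map_tmul, hg]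
    induction w using Tens.induction_on with
    | zero => simp
    | tmul v e => rfl
    | add x y hx hy => simp only [Tens.add_tmul, map_add, hx, hy]
  | add x y hx hy => simp only [map_add, hx, hy]

/-- The right `D`-comodule `N □_C M`. -/
noncomputable def IsCotensorable.obj (h : lam.IsCotensorable) (N : RComod C) : RComod D where
  carrier := lam.cotensor N
  coact := h.coact N
  coassoc x := h.injective₂ N (by
    let g : Tens B (lam.cotensor N) D →ₗ[Bᵐᵒᵖ] Tens B (Tens A N M) D :=
      { toFun := Tens.map (lam.incl N) (LinearMap.id (R := B))
        map_add' := map_add _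
        map_smul' := fun b z => by
          induction z using Tens.induction_on with
          | zero => simp
          | tmul x d => rfl
          | add x y hx hy => simp only [smul_add, map_add, hx, hy] }
    have hg : g ∘ₗ h.coact N = LRComod.tensCoact N M ∘ₗ lam.incl N :=
      LinearMap.ext fun x => h.incl_coact N x
    rw [map_assoc (lam.incl N) _ g (fun _ => rfl), Tens.map_map, hg]
    have e1 : Tens.map (LRComod.tensCoact N M ∘ₗ lam.incl N)
        (LinearMap.id (R := B) (M := D) ∘ₗ LinearMap.id (R := B)) (h.coact N x) =
        Tens.map (LRComod.tensCoact N M) (LinearMap.id (R := B) (M := D))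
          (LRComod.tensCoact N M (lam.incl N x)) := by
      rw [← h.incl_coact, Tens.map_map]
    have e2 : Tens.map (lam.incl N) (LinearMap.id (R := B))
        (Tens.map (LinearMap.id (R := Bᵐᵒᵖ)) D.comul.left (h.coact N x)) =
        Tens.map (LinearMap.id (R := Bᵐᵒᵖ)) D.comul.left
          (LRComod.tensCoact N M (lam.incl N x)) := by
      rw [← h.incl_coact, Tens.map_map, Tens.map_map, LinearMap.comp_id, LinearMap.id_comp,
        LinearMap.comp_id, LinearMap.id_comp]
    rw [e1, e2]
    exact (M.tens N).coassoc (lam.incl N x))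
  counit x := Subtype.ext (by
    have e : ∀ z : Tens B (lam.cotensor N) D,
        lam.incl N (Tens.rid (Tens.map (LinearMap.id (R := Bᵐᵒᵖ)) D.counit.left z)) =
        Tens.rid (Tens.map (LinearMap.id (R := Bᵐᵒᵖ)) D.counit.left
          (Tens.map (lam.incl N) (LinearMap.id (R := B)) z)) := by
      intro z
      induction z using Tens.induction_on with
      | zero => simp
      | tmul x d => rfl
      | add x y hx hy => simp only [map_add, hx, hy]
    refine (e (h.coact N x)).trans ?_
    rw [h.incl_coact]
    exact (M.tens N).counit (lam.incl N x))

variable (lam) in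
/-- `f ⊗ M` maps `N □_C M` to `N' □_C M`. -/
theorem omega_map {N N' : RComod C} (f : N ⟶ N') (x : Tens A N M) (hx : lam.omega N x = 0) :
    lam.omega N' (Tens.map f.lin (LinearMap.id (R := A)) x) = 0 := by
  have e : ∀ x : Tens A N M, lam.omega N' (Tens.map f.lin (LinearMap.id (R := A)) x) =
      Tens.map f.lin (LinearMap.id (R := A)) (lam.omega N x) := by
    intro x
    induction x using Tens.induction_on with
    | zero => simp
    | tmul n m =>
      rw [Tens.map_tmul, omega_tmul, omega_tmul, map_sub, Tens.map_tmul, ← f.comm]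
      congr 1
      induction N.coact n using Tens.induction_on with
      | zero => simp
      | tmul n c => rfl
      | add x y hx hy => simp only [Tens.add_tmul, map_add, hx, hy]
    | add x y hx hy => simp only [map_add, hx, hy]
  rw [e, hx, map_zero]

variable (lam) in
/-- The map `f □_C M`. -/
def cotensorMap {N N' : RComod C} (f : N ⟶ N') : lam.cotensor N →ₗ[Bᵐᵒᵖ] lam.cotensor N' where
  toFun x := ⟨Tens.map f.lin (LinearMap.id (R := A)) x.1, omega_map lam f x.1 x.2⟩
  map_add' x y := Subtype.ext (map_add _ x.1 y.1)
  map_smul' b x := Subtype.ext ((M.tensMap f.lin).lin.map_smul b x.1)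

/-- `f ⊗ M` as a homomorphism of right `B`-modules. -/
def tensMapLin (M : LRComod A D) {N N' : RComod C} (f : N ⟶ N') :
    Tens A N M →ₗ[Bᵐᵒᵖ] Tens A N' M := (M.tensMap f.lin).lin

/-- The functor `- □_C M` from right `C`-comodules to right `D`-comodules. -/
noncomputable def IsCotensorable.functor (h : lam.IsCotensorable) : RComod C ⥤ RComod D where
  obj N := h.obj N
  map {N N'} f :=
    { lin := cotensorMap lam f
      comm := fun (x : lam.cotensor N) => h.injective N' (by
        refine Eq.trans ?_ (h.incl_coact N' (cotensorMap lam f x)).symm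
        have e : Tens.map (tensMapLin M f) (LinearMap.id (R := B))
            (LRComod.tensCoact N M (lam.incl N x)) =
            LRComod.tensCoact N' M (tensMapLin M f (lam.incl N x)) :=
          (M.tensMap f.lin).comm (lam.incl N x)
        rw [← h.incl_coact, Tens.map_map] at e
        refine Eq.trans ?_ e
        exact Tens.map_map _ _ _ _ (h.coact N x)) }
  map_id N := RComod.hom_ext fun x => Subtype.ext (Tens.map_id x.1)
  map_comp f g := RComod.hom_ext fun x => Subtype.ext (by
    refine Eq.trans ?_ (Tens.map_map _ _ _ _ x.1).symm
    rfl)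

end CotensorFunctor

end LeftCoaction

end Cotensor

/-! ### The hypotheses -/

section Hypotheses

/-- `N` is flat as a left `B`-module: `- ⊗_B N` preserves injections. -/
def IsFlatLeft (B N : Type u) [Ring B] [AddCommGroup N] [Module B N] : Prop :=
  ∀ (X Y : Type u) [AddCommGroup X] [Module Bᵐᵒᵖ X] [AddCommGroup Y] [Module Bᵐᵒᵖ Y]
    (f : X →ₗ[Bᵐᵒᵖ] Y), Function.Injective f →
      Function.Injective (Tens.map f (LinearMap.id (R := B) (M := N)))

/-- `M` is flat as a right `B`-module: `M ⊗_B -` preserves injections. -/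
def IsFlatRight (B M : Type u) [Ring B] [AddCommGroup M] [Module Bᵐᵒᵖ M] : Prop :=
  ∀ (X Y : Type u) [AddCommGroup X] [Module B X] [AddCommGroup Y] [Module B Y]
    (f : X →ₗ[B] Y), Function.Injective f →
      Function.Injective (Tens.map (LinearMap.id (R := Bᵐᵒᵖ) (M := M)) f)

/-- A von Neumann regular ring. -/
def IsVonNeumannRegular (R : Type u) [Ring R] : Prop := ∀ a : R, ∃ b : R, a * b * a = a

variable {C : Coring k A} (N : RComod C)

/-- `ρ_N ⊗ C : N ⊗_A C → N ⊗_A C ⊗_A C` as a morphism of right comodules. -/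
def RComod.coactTens : C.regular.tens N ⟶ C.regular.tens (Tens A N C) :=
  C.regular.tensMap N.coact

/-- `N ⊗ Δ : N ⊗_A C → N ⊗_A C ⊗_A C` as a morphism of right comodules (it is the coaction of the
comodule `N ⊗_A C`). -/
def RComod.tensComul : C.regular.tens N ⟶ C.regular.tens (Tens A N C) where
  lin := LRComod.tensCoact N C.regular
  comm z := by
    have key : ∀ w : Tens A (Tens A N C) C,
        LRComod.tensCoact (Tens A N C) C.regular w =
          Tens.assoc.symm (Tens.map (LinearMap.id (R := Aᵐᵒᵖ)) C.comul.left w) := fun _ => rfl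
    refine Eq.trans ?_ (key _).symm
    exact (Tens.assoc.symm_apply_eq.2 ((C.regular.tens N).coassoc z).symm).symm

/-- The morphism `ρ_N ⊗ C - N ⊗ Δ` of right comodules. -/
def RComod.omegaC : C.regular.tens N ⟶ C.regular.tens (Tens A N C) :=
  N.coactTens - N.tensComul

variable (C) in
/-- The comultiplication `Δ : C → C ⊗_A C` as a morphism of right comodules. -/
def Coring.comulHom : C.regular.toRComod ⟶ C.regular.tens C where
  lin := C.comul.right
  comm (c : C) := (Tens.assoc.symm_apply_eq.2 (C.coassoc c).symm).symm

variable {B : Type u} [Ring B] [Algebra k B] {D : Coring k B} (F : RComod C ⥤ RComod D)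

/-- `F` preserves coproducts (of families indexed by arbitrary sets). -/
def PreservesCoproducts : Prop :=
  ∀ J : Type u, PreservesColimitsOfShape (Discrete J) F

/-- `F` preserves direct limits (colimits of systems indexed by directed sets). -/
def PreservesDirectLimits : Prop :=
  ∀ (J : Type u) [Preorder J] [IsDirectedOrder J] [Nonempty J], PreservesColimitsOfShape J F

/-- `Υ_{N,C}` and `Υ_{N ⊗_A C,C}` are isomorphisms for all right comodules `N`. -/
def UpsilonIso [F.Additive] [F.Linear k] : Prop :=
  ∀ N : RComod C,
    IsIso (upsilon F N C.regular) ∧ IsIso (upsilon F (Tens A N C) C.regular)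

end Hypotheses

end Comodules

/-!
Write `M = F(C)` and `Υ_X : X ⊗_A M → F(X ⊗_A C)`. Once `Υ_N` and `Υ_{N ⊗ C}` are isomorphisms for
all comodules `N`, the bicomodule structure is `λ = Υ_C⁻¹ ∘ F(Δ)`: the axioms are the images under
`F` of those of `C`, transported by the naturality of `Υ` (`leftCoactionOfUpsilon`). The same
naturality shows that `Υ` carries `ω_N = ρ_N ⊗ M - N ⊗ λ` to `F(ρ_N ⊗ C - N ⊗ Δ)`
(`upsilon_omega`). In the category of comodules `ρ_N : N → N ⊗ C` is a kernel of `ρ_N ⊗ C - N ⊗ Δ`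
(`RComod.coactIsLimit`). If `F` preserves it, then `F(N)` is a kernel of `ω_N`, as is `N □_C M`,
so the two are naturally isomorphic (`nonempty_iso_cotensor`).

In alternative (I) this kernel is preserved by assumption, and the purity of the cotensor product
follows from flatness. In alternative (II) a bicolinear retraction `γ` of `Δ` splits the fork `N →
N ⊗ C ⇉ N ⊗ C ⊗ C` by `N ⊗ γ` and `(N ⊗ εγ)(ρ_N ⊗ C)` (`Coring.IsCoseparable.exists_splitting`).
Every additive functor preserves a split fork, and the splitting makes `ω_N` a regular map, whose
kernel is preserved by all tensor products.

The hypothesis on `Υ` follows from the preservation of colimits. The functors `- ⊗_T M` have right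
adjoints `Hom(M, -)`, so the modules at which `Υ` is an isomorphism are closed under those
colimits that `F` preserves, and under finite sums and retracts. They contain the ring, hence all
modules if `F` preserves colimits (free presentations), all projective modules if `F` preserves
coproducts, and all modules over a von Neumann regular ring if `F` preserves direct limits: over
such a ring a finitely generated submodule of a free module is a direct summand
(`Submodule.exists_mkQ_section`), so every module is a direct limit of projective ones.
-/

universe w w'

/-! ### Exactness of the tensor product -/

namespace Tens

section Exactness

variable {A : Type*} [Ring A] {M M' M'' N : Type*} [AddCommGroup M] [Module Aᵐᵒᵖ M]
  [AddCommGroup M'] [Module Aᵐᵒᵖ M'] [AddCommGroup M''] [Module Aᵐᵒᵖ M'']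
  [AddCommGroup N] [Module A N]

theorem map_sum_left {ι : Type*} (s : Finset ι) (f : ι → M →ₗ[Aᵐᵒᵖ] M') (g : N →ₗ[A] N)
    (x : Tens A M N) : map (∑ i ∈ s, f i) g x = ∑ i ∈ s, map (f i) g x := by
  classical
  induction s using Finset.induction_on with
  | empty => simp [map_zero_left]
  | insert i s hi ih => rw [Finset.sum_insert hi, Finset.sum_insert hi, map_add_left, ih]

theorem map_sub_left (f f' : M →ₗ[Aᵐᵒᵖ] M') (x : Tens A M N) :
    map (f - f') (LinearMap.id (R := A)) x =
      map f (LinearMap.id (R := A)) x - map f' (LinearMap.id (R := A)) x := by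
  rw [sub_eq_add_neg, map_add_left, map_neg_left, sub_eq_add_neg]

theorem map_comp_left (f : M →ₗ[Aᵐᵒᵖ] M') (f' : M' →ₗ[Aᵐᵒᵖ] M'') (x : Tens A M N) :
    map (f' ∘ₗ f) (LinearMap.id (R := A)) x =
      map f' (LinearMap.id (R := A)) (map f (LinearMap.id (R := A)) x) := by
  rw [map_map, LinearMap.id_comp]

/-- Right exactness of the tensor product: the kernel of `p ⊗ N` is the image of `i ⊗ N`. The class
of `x ⊗ n` modulo that image depends only on `p x` and `n`, which yields an inverse of the map
induced by `p ⊗ N` on the quotient. -/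
theorem exists_map_eq_of_exact (i : M →ₗ[Aᵐᵒᵖ] M') (p : M' →ₗ[Aᵐᵒᵖ] M'')
    (hp : Function.Surjective p) (hip : ∀ x, p x = 0 → ∃ y, i y = x) (z : Tens A M' N)
    (hz : map p (LinearMap.id (R := A)) z = 0) :
    ∃ y : Tens A M N, map i (LinearMap.id (R := A)) y = z := by
  let S : AddSubgroup (Tens A M' N) := (map i (LinearMap.id (R := A) (M := N))).range
  have hS : ∀ x x' n, p x = p x' →
      (tmul A x n : Tens A M' N ⧸ S) = (tmul A x' n : Tens A M' N) := fun x x' n h => by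
    rw [QuotientAddGroup.eq_iff_sub_mem, ← sub_tmul]
    obtain ⟨y, hy⟩ := hip (x - x') (by rw [map_sub, h, sub_self])
    exact ⟨tmul A y n, by rw [map_tmul, hy]; rfl⟩
  let s := Function.surjInv hp
  have hs : ∀ x, p (s x) = x := Function.surjInv_eq hp
  let r : Tens A M'' N →+ Tens A M' N ⧸ S :=
    lift (fun x n => ((tmul A (s x) n : Tens A M' N) : Tens A M' N ⧸ S))
      (fun x x' n => by
        rw [← QuotientAddGroup.mk_add, ← add_tmul]
        exact hS _ _ _ (by rw [map_add, hs, hs, hs]))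
      (fun x n n' => by rw [← QuotientAddGroup.mk_add, ← tmul_add])
      (fun a x n => by
        rw [← smul_tmul]
        exact hS _ _ _ (by rw [map_smul, hs, hs]))
  have hr : ∀ w : Tens A M' N, r (map p (LinearMap.id (R := A)) w) = (w : Tens A M' N ⧸ S) := by
    intro w
    induction w using induction_on with
    | zero => simp
    | tmul x n => exact hS _ _ _ (hs _)
    | add x y hx hy => rw [map_add, map_add, hx, hy, QuotientAddGroup.mk_add]
  have := hr z
  rw [hz, map_zero] at this
  exact (QuotientAddGroup.eq_zero_iff z).1 this.symm

theorem lid_injective : Function.Injective (lid : Tens A A N →+ N) := by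
  have h : ∀ x : Tens A A N, tmul A 1 (lid x) = x := fun x => by
    induction x using induction_on with
    | zero => simp
    | tmul a n => rw [lid_tmul, ← smul_tmul]; simp
    | add x y hx hy => rw [map_add, tmul_add, hx, hy]
  exact Function.LeftInverse.injective h

end Exactness

variable {B D : Type u} [Ring B] [AddCommGroup D] [Module B D]

/-- Tensoring with a flat module preserves kernels. -/
theorem exists_map_ker_eq_of_flat (hD : IsFlatLeft B D) {M M' : Type u} [AddCommGroup M]
    [Module Bᵐᵒᵖ M] [AddCommGroup M'] [Module Bᵐᵒᵖ M'] (f : M →ₗ[Bᵐᵒᵖ] M') (x : Tens B M D)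
    (hx : map f (LinearMap.id (R := B)) x = 0) :
    ∃ y : Tens B (LinearMap.ker f) D,
      map (LinearMap.ker f).subtype (LinearMap.id (R := B)) y = x := by
  refine exists_map_eq_of_exact _ f.rangeRestrict f.surjective_rangeRestrict
    (fun z hz => ⟨⟨z, ?_⟩, rfl⟩) x (hD _ _ f.range.subtype f.range.injective_subtype ?_)
  · rw [map_zero, map_map]
    exact hx
  · exact congrArg Subtype.val hz

/-- If `D` is flat, then `- ⊗ (D ⊗ D)`, being `(- ⊗ D) ⊗ D`, preserves injections. -/
theorem map_injective_tens_of_flat {k : Type u} [CommRing k] [Algebra k B] {D : Coring k B}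
    (hD : IsFlatLeft B D) {M M' : Type u} [AddCommGroup M] [Module Bᵐᵒᵖ M] [AddCommGroup M']
    [Module Bᵐᵒᵖ M']
    (f : M →ₗ[Bᵐᵒᵖ] M') (hf : Function.Injective f) :
    Function.Injective (map f (LinearMap.id (R := B) (M := Tens B D D))) := by
  let g : Tens B M D →ₗ[Bᵐᵒᵖ] Tens B M' D :=
    { toFun := map f (LinearMap.id (R := B))
      map_add' := map_add _
      map_smul' := fun b z => by
        induction z using Tens.induction_on with
        | zero => simp
        | tmul x d => rfl
        | add x y hx hy => simp only [smul_add, map_add, hx, hy] }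
  have hg : Function.Injective (map g (LinearMap.id (R := B) (M := D))) :=
    hD _ _ g (hD _ _ f hf)
  have h : ∀ z, map f (LinearMap.id (R := B) (M := Tens B D D)) z =
      assoc (map g (LinearMap.id (R := B)) (assoc.symm z)) := fun z => by
    rw [← LeftCoaction.map_assoc f _ g (fun _ => rfl), AddEquiv.apply_symm_apply]
  intro x y hxy
  rw [h, h] at hxy
  exact assoc.symm.injective (hg (assoc.injective hxy))

end Tens

section Corings

variable {k : Type u} [CommRing k] {A : Type u} [Ring A] [Algebra k A] {C : Coring k A}

/-! ### The coaction as a kernel -/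

namespace RComod

/-- The coaction `ρ_N : N → N ⊗_A C`, as a morphism of right comodules. -/
def coactHom (N : RComod C) : N ⟶ C.regular.tens N where
  lin := N.coact
  comm n := (Tens.assoc.symm_apply_eq.2 (N.coassoc n).symm).symm

/-- The map `N ⊗ ε : N ⊗_A C → N`. -/
def counitLin (N : RComod C) : Tens A N C →ₗ[Aᵐᵒᵖ] N where
  toFun z := Tens.rid (Tens.map (LinearMap.id (R := Aᵐᵒᵖ)) C.counit.left z)
  map_add' x y := by simp
  map_smul' a z := by
    induction z using Tens.induction_on with
    | zero => simp
    | tmul n c =>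
      have : C.counit.left (a • c) = C.counit.left c * a.unop := C.counit.map_right_smul a.unop c
      simp [this, mul_smul]
    | add x y hx hy => simp only [smul_add, map_add, hx, hy]

theorem counitLin_tmul (N : RComod C) (n : N) (c : C) :
    N.counitLin (Tens.tmul A n c) = op (C.counit c) • n := rfl

theorem counitLin_coact (N : RComod C) (n : N) : N.counitLin (N.coact n) = n := N.counit n

theorem coactHom_omegaC (N : RComod C) : N.coactHom ≫ N.omegaC = 0 :=
  RComod.hom_ext fun n => by
    have h : Tens.map N.coact (LinearMap.id (R := A)) (N.coact n) =
        LRComod.tensCoact N C.regular (N.coact n) := N.coactHom.comm n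
    change (N.coactTens - N.tensComul).lin (N.coact n) = 0
    rw [sub_lin]
    exact sub_eq_zero.2 h

/-- On the kernel of `ρ_N ⊗ C - N ⊗ Δ` the map `N ⊗ ε` is inverse to `ρ_N`: there
`ρ_N (N ⊗ ε) = (N ⊗ C ⊗ ε)(ρ_N ⊗ C)` agrees with `(N ⊗ C ⊗ ε)(N ⊗ Δ) = 1`. -/
theorem coact_counitLin (N : RComod C) (w : Tens A N C)
    (hw : N.omegaC.lin w = 0) : N.coact (N.counitLin w) = w := by
  have h : Tens.map N.coact (LinearMap.id (R := A)) w = LRComod.tensCoact N C.regular w := by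
    have : (N.coactTens - N.tensComul).lin w = 0 := hw
    rw [sub_lin] at this
    exact sub_eq_zero.1 this
  have e₁ : ∀ w : Tens A N C, N.coact (N.counitLin w) =
      (C.regular.tens N).counitLin (Tens.map N.coact (LinearMap.id (R := A)) w) := by
    intro w
    let g : Tens A N C →+ Tens A N C :=
      (C.regular.tens N).counitLin.toAddMonoidHom.comp (Tens.map N.coact (LinearMap.id (R := A)))
    have : (N.coact.comp N.counitLin).toAddMonoidHom = g := Tens.hom_ext fun n c => by
      refine (congrArg N.coact (counitLin_tmul N n c)).trans ((map_smul N.coact _ _).trans ?_)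
      rfl
    exact DFunLike.congr_fun this w
  rw [e₁, h]
  exact (C.regular.tens N).counitLin_coact w

/-- A linear map `g` as a comodule morphism, if its composite with a comodule morphism `i` is
colinear and `i ⊗ C` is injective. -/
def liftOfInjective {P N W : RComod C} (i : N ⟶ W)
    (hi : Function.Injective (Tens.map i.lin (LinearMap.id (R := A) (M := C))))
    (g : P →ₗ[Aᵐᵒᵖ] N) (f : P ⟶ W) (h : ∀ x, i.lin (g x) = f.lin x) : P ⟶ N where
  lin := g
  comm x := hi (by
    have e : i.lin ∘ₗ g = f.lin := LinearMap.ext h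
    rw [Tens.map_map, e, LinearMap.id_comp, f.comm, i.comm, h])

/-- The coaction is a split injection of modules, hence stays injective after tensoring with `C`. -/
theorem map_coact_injective (N : RComod C) :
    Function.Injective (Tens.map N.coact (LinearMap.id (R := A) (M := C))) := by
  have h : ∀ z, Tens.map N.counitLin (LinearMap.id (R := A) (M := C))
      (Tens.map N.coact (LinearMap.id (R := A)) z) = z := fun z => by
    have e : N.counitLin ∘ₗ N.coact = LinearMap.id := LinearMap.ext N.counitLin_coact
    rw [Tens.map_map, e, LinearMap.id_comp, Tens.map_id]
  exact Function.LeftInverse.injective h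

/-- The coaction is the kernel of `ρ_N ⊗ C - N ⊗ Δ` in the category of comodules: a morphism `f`
into that kernel is `ρ_N` composed with `(N ⊗ ε) f`. -/
def coactIsLimit (N : RComod C) : IsLimit (KernelFork.ofι N.coactHom N.coactHom_omegaC) :=
  Fork.IsLimit.mk _
    (fun s => liftOfInjective N.coactHom N.map_coact_injective (N.counitLin ∘ₗ s.ι.lin) s.ι
      (fun x => N.coact_counitLin _
        (congrArg (fun f : s.pt ⟶ _ => f.lin x) (KernelFork.condition s))))
    (fun s => RComod.hom_ext fun x =>
      N.coact_counitLin _ (congrArg (fun f : s.pt ⟶ _ => f.lin x) (KernelFork.condition s)))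
    (fun s m hm => RComod.hom_ext fun x => by
      refine (N.counitLin_coact _).symm.trans (congrArg N.counitLin ?_)
      exact congrArg (fun f : s.pt ⟶ _ => f.lin x) hm)

end RComod

/-! ### The left coaction on `F(C)` -/

section LeftCoactionOfUpsilon

variable {B : Type u} [Ring B] [Algebra k B] {D : Coring k B}
variable (F : RComod C ⥤ RComod D) [F.Additive] [F.Linear k]

theorem Tens.assoc_symm_tmul_eq_map {M N L : Type*} [AddCommGroup M] [Module Aᵐᵒᵖ M]
    [AddCommGroup N] [Module A N] [Module Bᵐᵒᵖ N] [SMulCommClass A Bᵐᵒᵖ N] [AddCommGroup L]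
    [Module B L] (m : M)
    (f : N →ₗ[Bᵐᵒᵖ] Tens A M N) (hf : ∀ n, f n = Tens.tmul A m n) (w : Tens B N L) :
    Tens.assoc.symm (Tens.tmul A m w) = Tens.map f (LinearMap.id (R := B)) w := by
  induction w using Tens.induction_on with
  | zero => simp
  | tmul n l => rw [Tens.map_tmul, hf]; rfl
  | add x y hx hy => simp only [Tens.tmul_add, map_add, hx, hy]

/-- The left action of `a` on the coring, as a homomorphism of right modules. -/
def Coring.leftMul (C : Coring k A) (a : A) : C →ₗ[Aᵐᵒᵖ] C := (C.regular.act a).lin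

theorem Tens.map_leftMul (M : Type u) [AddCommGroup M] [Module A M] (a : A) (w : Tens A C M) :
    Tens.map (C.leftMul a) (LinearMap.id (R := A)) w = a • w :=
  Tens.map_eq_smul a _ (fun _ => rfl) w

theorem Coring.comulHom_leftMul (a : A) :
    C.comulHom ≫ C.regular.tensMap (C.leftMul a) = C.regular.act a ≫ C.comulHom :=
  RComod.hom_ext fun c =>
    (Tens.map_leftMul C a (C.comul c)).trans (map_smul C.comul.left a c).symm

/-- `Υ` at `N ⊗ C` in terms of `Υ` at `C`: naturality along `n ⊗ - : C → N ⊗ C`. -/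
theorem upsilon_assoc_symm (N : RComod C) (n : N) (w : Tens A C (C.regular.mapFunctor F)) :
    (upsilon F (Tens A N C) C.regular).lin (Tens.assoc.symm (Tens.tmul A n w)) =
      (F.map (C.regular.tensMap (C.regular.insert N n).lin)).lin
        ((upsilon F C C.regular).lin w) := by
  refine (congrArg _
    (Tens.assoc_symm_tmul_eq_map n (C.regular.insert N n).lin (fun _ => rfl) w)).trans ?_
  exact congrArg (fun f : (C.regular.mapFunctor F).tens C ⟶ _ => f.lin w)
    (upsilon_natural F C C.regular (C.regular.insert N n).lin)

/-- `Υ` intertwines `ρ_N ⊗ F(C)` with `F(ρ_N ⊗ C)`. -/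
theorem upsilon_map_coact (N : RComod C) (x : Tens A N (C.regular.mapFunctor F)) :
    (upsilon F (Tens A N C) C.regular).lin (Tens.map N.coact (LinearMap.id (R := A)) x) =
      (F.map N.coactTens).lin ((upsilon F N C.regular).lin x) :=
  congrArg (fun f : (C.regular.mapFunctor F).tens N ⟶ _ => f.lin x)
    (upsilon_natural F N C.regular N.coact)

theorem RComod.lin_injective_of_isIso {M N : RComod D} (f : M ⟶ N) [IsIso f] :
    Function.Injective f.lin := by
  have h : ∀ x, (inv f).lin (f.lin x) = x := fun x =>
    congrArg (fun f : M ⟶ M => f.lin x) (IsIso.hom_inv_id f)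
  exact Function.LeftInverse.injective h

theorem RComod.lin_inv_apply {M N : RComod D} (f : M ⟶ N) [IsIso f] (x : N) :
    f.lin ((inv f).lin x) = x :=
  congrArg (fun f : N ⟶ N => f.lin x) (IsIso.inv_hom_id f)

omit [F.Additive] [F.Linear k] in
theorem RComod.lin_comp_map {N P Q R : RComod C} {f : N ⟶ P} {g : P ⟶ Q}
    {f' : N ⟶ R} {g' : R ⟶ Q} (h : f ≫ g = f' ≫ g') (y : F.obj N) :
    (F.map g).lin ((F.map f).lin y) = (F.map g').lin ((F.map f').lin y) := by
  have e := congrArg F.map h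
  rw [F.map_comp, F.map_comp] at e
  exact congrArg (fun f : F.obj N ⟶ _ => f.lin y) e

variable [IsIso (upsilon F C C.regular)]

/-- The morphism `Υ_{C,C}⁻¹ ∘ F(Δ) : F(C) → C ⊗_A F(C)`. -/
noncomputable def upsilonCoact :
    F.obj C.regular.toRComod ⟶ (C.regular.mapFunctor F).tens C :=
  F.map C.comulHom ≫ inv (upsilon F C C.regular)

/-- The map underlying `upsilonCoact`. -/
noncomputable def upsilonCoactLin :
    C.regular.mapFunctor F →ₗ[Bᵐᵒᵖ] Tens A C (C.regular.mapFunctor F) := (upsilonCoact F).lin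

theorem upsilon_upsilonCoact (y : C.regular.mapFunctor F) :
    (upsilon F C C.regular).lin (upsilonCoactLin F y) = (F.map C.comulHom).lin y :=
  RComod.lin_inv_apply (upsilon F C C.regular) _

/-- `λ` is left `A`-linear since `Δ` is and `Υ` is natural along left multiplication on `C`. -/
theorem upsilonCoactLin_smul (a : A) (y : C.regular.mapFunctor F) :
    upsilonCoactLin F (a • y) = a • upsilonCoactLin F y := by
  apply RComod.lin_injective_of_isIso (upsilon F C C.regular)
  refine (upsilon_upsilonCoact F (a • y)).trans ?_
  refine (RComod.lin_comp_map F (Coring.comulHom_leftMul a).symm y).trans ?_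
  rw [← upsilon_upsilonCoact, ← Tens.map_leftMul]
  exact (congrArg (fun f : (C.regular.mapFunctor F).tens C ⟶ _ => f.lin (upsilonCoactLin F y))
    (upsilon_natural F C C.regular (C.leftMul a))).symm

/-- `Υ` intertwines `N ⊗ λ` with `F(N ⊗ Δ)`. The variable `L` stands for `λ` as a left linear
map. -/
theorem upsilon_map_upsilonCoact (N : RComod C)
    (L : C.regular.mapFunctor F →ₗ[A] Tens A C (C.regular.mapFunctor F))
    (hL : ∀ y, L y = upsilonCoactLin F y) (x : Tens A N (C.regular.mapFunctor F)) :
    (upsilon F (Tens A N C) C.regular).lin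
        (Tens.assoc.symm (Tens.map (LinearMap.id (R := Aᵐᵒᵖ)) L x)) =
      (F.map N.tensComul).lin ((upsilon F N C.regular).lin x) := by
  let f : Tens A N (C.regular.mapFunctor F) →+ F.obj (C.regular.tens (Tens A N C)) :=
    (upsilon F (Tens A N C) C.regular).lin.toAddMonoidHom.comp
      (Tens.assoc.symm.toAddMonoidHom.comp (Tens.map (LinearMap.id (R := Aᵐᵒᵖ)) L))
  let g : Tens A N (C.regular.mapFunctor F) →+ F.obj (C.regular.tens (Tens A N C)) :=
    (F.map N.tensComul).lin.toAddMonoidHom.comp (upsilon F N C.regular).lin.toAddMonoidHom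
  have h : f = g := Tens.hom_ext fun n y => by
    let i : C →ₗ[Aᵐᵒᵖ] Tens A N C := (C.regular.insert N n).lin
    have e : C.comulHom ≫ C.regular.tensMap i =
        C.regular.insert N n ≫ N.tensComul := RComod.hom_ext fun c =>
      (Tens.assoc_symm_tmul_eq_map (B := A) n i (fun _ => rfl) (C.comul c)).symm
    change (upsilon F (Tens A N C) C.regular).lin (Tens.assoc.symm (Tens.tmul A n (L y))) = _
    rw [hL]
    refine (upsilon_assoc_symm F N n (upsilonCoactLin F y)).trans ?_
    rw [upsilon_upsilonCoact]
    exact RComod.lin_comp_map F e y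
  exact DFunLike.congr_fun h x

/-- If `Υ_{C,C}` and `Υ_{C ⊗ C,C}` are isomorphisms, `Υ_{C,C}⁻¹ ∘ F(Δ)` makes `F(C)` a
bicomodule. -/
noncomputable def leftCoactionOfUpsilon
    [IsIso (upsilon F (Tens A C C) C.regular)] : LeftCoaction C (C.regular.mapFunctor F) where
  coact :=
    { left :=
        { toFun := upsilonCoactLin F
          map_add' := map_add _
          map_smul' := upsilonCoactLin_smul F }
      map_right_smul := fun b y => map_smul (upsilonCoactLin F) (op b) y }
  coassoc y := by
    -- both sides are compared in `F(C ⊗ C ⊗ C)`, where the identity is `F` of coassociativity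
    refine Tens.assoc.symm.injective ((AddEquiv.symm_apply_apply _ _).trans ?_)
    apply RComod.lin_injective_of_isIso (upsilon F (Tens A C C) C.regular)
    refine (upsilon_map_coact F C.regular.toRComod (upsilonCoactLin F y)).trans ?_
    refine Eq.trans ?_ (upsilon_map_upsilonCoact F C.regular.toRComod _ (fun _ => rfl)
      (upsilonCoactLin F y)).symm
    change _ = (F.map C.regular.toRComod.tensComul).lin
      ((upsilon F C C.regular).lin (upsilonCoactLin F y))
    rw [upsilon_upsilonCoact]
    refine (congrArg _ (upsilon_upsilonCoact F y)).trans ?_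
    refine RComod.lin_comp_map F (RComod.hom_ext fun c => ?_) y
    exact C.regular.toRComod.coactHom.comm c
  counit y := by
    have e : C.comulHom ≫ C.regular.tensMap C.counit.right ≫ C.regular.unitHom = 𝟙 _ :=
      RComod.hom_ext fun c => C.counit_left c
    have h : (C.regular.mapFunctor F).tensMap C.counit.right ≫ (C.regular.mapFunctor F).unitHom =
        upsilon F C C.regular ≫ F.map (C.regular.tensMap C.counit.right ≫ C.regular.unitHom) := by
      refine (congrArg (fun f => (C.regular.mapFunctor F).tensMap C.counit.right ≫ f)
        (upsilon_unit F C.regular).symm).trans ?_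
      refine (Category.assoc _ _ _).symm.trans ?_
      refine (congrArg (fun f => f ≫ F.map C.regular.unitHom)
        (upsilon_natural F C C.regular C.counit.right)).trans ?_
      rw [Category.assoc, F.map_comp]
    refine (congrArg (fun f : (C.regular.mapFunctor F).tens C ⟶ _ => f.lin (upsilonCoactLin F y))
      h).trans ?_
    refine (congrArg (F.map (C.regular.tensMap C.counit.right ≫ C.regular.unitHom)).lin
      (upsilon_upsilonCoact F y)).trans ?_
    have e' := congrArg F.map e
    rw [F.map_comp, F.map_id] at e'
    exact congrArg (fun f : F.obj C.regular.toRComod ⟶ _ => f.lin y) e'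
  compat y :=
    (congrArg Tens.assoc ((upsilonCoact F).comm y)).trans (AddEquiv.apply_symm_apply _ _)

end LeftCoactionOfUpsilon

/-! ### Comparison of `F` with the cotensor functor -/

section Comparison

variable {B : Type u} [Ring B] [Algebra k B] {D : Coring k B}
variable (F : RComod C ⥤ RComod D) [F.Additive] [F.Linear k]

/-- `Υ` intertwines `ω_N = ρ_N ⊗ F(C) - N ⊗ λ` with `F(ρ_N ⊗ C - N ⊗ Δ)`. -/
theorem upsilon_omega [IsIso (upsilon F C C.regular)] [IsIso (upsilon F (Tens A C C) C.regular)]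
    (N : RComod C) (x : Tens A N (C.regular.mapFunctor F)) :
    (upsilon F (Tens A N C) C.regular).lin
        (Tens.assoc.symm ((leftCoactionOfUpsilon F).omega N x)) =
      (F.map N.omegaC).lin ((upsilon F N C.regular).lin x) := by
  have e : Tens.assoc.symm ((leftCoactionOfUpsilon F).omega N x) =
      Tens.map N.coact (LinearMap.id (R := A)) x -
        Tens.assoc.symm (Tens.map (LinearMap.id (R := Aᵐᵒᵖ))
          (leftCoactionOfUpsilon F).coact.left x) :=
    (map_sub Tens.assoc.symm _ _).trans
      (congrArg (· - _) (AddEquiv.symm_apply_apply Tens.assoc _))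
  rw [e]
  refine (map_sub (upsilon F (Tens A N C) C.regular).lin _ _).trans ?_
  rw [RComod.omegaC, F.map_sub, RComod.sub_lin, LinearMap.sub_apply]
  exact congrArg₂ (· - ·) (upsilon_map_coact F N x)
    (upsilon_map_upsilonCoact F N _ (fun _ => rfl) x)

variable {F} {lam : LeftCoaction C (C.regular.mapFunctor F)}

/-- The inclusion of `N □_C M` in `N ⊗_A M`, as a morphism of right comodules. -/
def LeftCoaction.IsCotensorable.inclHom {M : LRComod A D} {lam : LeftCoaction C M}
    (h : lam.IsCotensorable) (N : RComod C) : h.obj N ⟶ M.tens N where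
  lin := lam.incl N
  comm := h.incl_coact N

theorem LeftCoaction.IsCotensorable.hom_ext {M : LRComod A D} {lam : LeftCoaction C M}
    (h : lam.IsCotensorable) {N : RComod C} {P : RComod D} {f g : P ⟶ h.obj N}
    (e : f ≫ h.inclHom N = g ≫ h.inclHom N) : f = g :=
  RComod.hom_ext fun x => Subtype.ext (congrArg (fun f : P ⟶ M.tens N => f.lin x) e)

/-- The morphism `f □_C M`. -/
noncomputable def LeftCoaction.IsCotensorable.mapHom {M : LRComod A D} {lam : LeftCoaction C M}
    (h : lam.IsCotensorable) {N N' : RComod C} (f : N ⟶ N') : h.obj N ⟶ h.obj N' :=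
  h.functor.map f

theorem LeftCoaction.IsCotensorable.mapHom_inclHom {M : LRComod A D} {lam : LeftCoaction C M}
    (h : lam.IsCotensorable) {N N' : RComod C} (f : N ⟶ N') :
    h.mapHom f ≫ h.inclHom N' = h.inclHom N ≫ M.tensMap f.lin := rfl

theorem RComod.coactHom_natural {N N' : RComod C} (f : N ⟶ N') :
    N.coactHom ≫ C.regular.tensMap f.lin = f ≫ N'.coactHom :=
  RComod.hom_ext f.comm

theorem RComod.map_coactHom_omegaC (F : RComod C ⥤ RComod D) [F.Additive] (N : RComod C) :
    F.map N.coactHom ≫ F.map N.omegaC = 0 := by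
  rw [← F.map_comp, N.coactHom_omegaC, F.map_zero]

/-- If every `F(ρ_N)` is a kernel of `F(ρ_N ⊗ C - N ⊗ Δ)`, then `F` is the cotensor functor: `Υ`
identifies that kernel with `N □_C F(C)`. -/
theorem nonempty_iso_cotensor (hU : UpsilonIso F)
    (hlam : ∀ (N : RComod C) (x : Tens A N (C.regular.mapFunctor F)),
      (upsilon F (Tens A N C) C.regular).lin (Tens.assoc.symm (lam.omega N x)) =
      (F.map N.omegaC).lin ((upsilon F N C.regular).lin x))
    (h : lam.IsCotensorable)
    (hF : ∀ N : RComod C,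
      Nonempty (IsLimit (KernelFork.ofι (F.map N.coactHom) (N.map_coactHom_omegaC F)))) :
    Nonempty (F ≅ h.functor) := by
  have hU₁ : ∀ N : RComod C, IsIso (upsilon F N C.regular) := fun N => (hU N).1
  have hU₂ : ∀ N : RComod C, IsIso (upsilon F (Tens A N C) C.regular) := fun N => (hU N).2
  -- `φ` identifies `F(ρ_N)` with a morphism to `N ⊗ F(C)`; its image lies in the cotensor product
  let φ (N : RComod C) : F.obj N ⟶ (C.regular.mapFunctor F).tens N :=
    F.map N.coactHom ≫ inv (upsilon F N C.regular)
  have hφ : ∀ N, φ N ≫ upsilon F N C.regular = F.map N.coactHom := fun N => by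
    simp only [φ, Category.assoc, IsIso.inv_hom_id, Category.comp_id]
  have hω : ∀ N x, lam.omega N ((φ N).lin x) = 0 := fun N x => by
    apply Tens.assoc.symm.injective
    apply RComod.lin_injective_of_isIso (upsilon F (Tens A N C) C.regular)
    refine (hlam N _).trans ?_
    rw [map_zero]
    refine Eq.trans ?_ (map_zero (upsilon F (Tens A N C) C.regular).lin).symm
    refine (congrArg (fun f : F.obj N ⟶ _ => (F.map N.omegaC).lin (f.lin x)) (hφ N)).trans ?_
    exact congrArg (fun f : F.obj N ⟶ _ => f.lin x) (N.map_coactHom_omegaC F)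
  let a (N : RComod C) : F.obj N ⟶ h.obj N :=
    RComod.liftOfInjective (h.inclHom N) (h.injective N)
      (LinearMap.codRestrict (lam.cotensor N) (φ N).lin (hω N)) (φ N) (fun _ => rfl)
  have ha : ∀ N, a N ≫ h.inclHom N = φ N := fun N => rfl
  have hι : ∀ N, (h.inclHom N ≫ upsilon F N C.regular) ≫ F.map N.omegaC = 0 := fun N =>
    RComod.hom_ext fun x => by
      have hx : lam.omega N (lam.incl N x) = 0 := x.2
      refine (hlam N (lam.incl N x)).symm.trans ?_
      rw [hx, map_zero]
      exact map_zero (upsilon F (Tens A N C) C.regular).lin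
  let b (N : RComod C) : h.obj N ⟶ F.obj N := (hF N).some.lift (KernelFork.ofι _ (hι N))
  have hb : ∀ N, b N ≫ F.map N.coactHom = h.inclHom N ≫ upsilon F N C.regular := fun N =>
    (hF N).some.fac (KernelFork.ofι _ (hι N)) WalkingParallelPair.zero
  have hab : ∀ N, a N ≫ b N = 𝟙 _ := fun N => by
    apply Fork.IsLimit.hom_ext (hF N).some
    change (a N ≫ b N) ≫ F.map N.coactHom = 𝟙 _ ≫ F.map N.coactHom
    rw [Category.assoc, hb, ← Category.assoc, ha, hφ, Category.id_comp]
  have hba : ∀ N, b N ≫ a N = 𝟙 _ := fun N => by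
    apply h.hom_ext
    rw [Category.assoc, ha, Category.id_comp, ← cancel_mono (upsilon F N C.regular),
      Category.assoc, hφ, hb]
  have nat : ∀ {N N' : RComod C} (f : N ⟶ N'), F.map f ≫ a N' = a N ≫ h.mapHom f := by
    intro N N' f
    apply h.hom_ext
    rw [Category.assoc, Category.assoc, ha, h.mapHom_inclHom, ← Category.assoc (a N), ha,
      ← cancel_mono (upsilon F N' C.regular), Category.assoc, hφ, Category.assoc, upsilon_natural,
      ← Category.assoc (φ N), hφ, ← F.map_comp, ← F.map_comp, RComod.coactHom_natural]
  exact ⟨NatIso.ofComponents (fun N => ⟨a N, b N, hab N, hba N⟩) nat⟩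

/-- If `D` is flat, then every left coaction satisfies the purity condition. -/
theorem LeftCoaction.isCotensorable_of_flat {M : LRComod A D} (lam : LeftCoaction C M)
    (hD : IsFlatLeft B D) : lam.IsCotensorable where
  injective _ := hD _ _ _ Subtype.val_injective
  exact N x hx := Tens.exists_map_ker_eq_of_flat hD (lam.omega N) x hx
  injective₂ _ := Tens.map_injective_tens_of_flat hD _ Subtype.val_injective

/-- The purity condition holds if `ω` is regular, i.e. there is a linear map `t` such that
`ω t ω = ω`: then `1 - t ω` is a projection onto the cotensor product. -/
theorem LeftCoaction.isCotensorable_of_regular {M : LRComod A D} (lam : LeftCoaction C M)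
    (hω : ∀ N : RComod C, ∃ t : Tens A N (Tens A C M) →ₗ[Bᵐᵒᵖ] Tens A N M,
      ∀ x, lam.omega N (t (lam.omega N x)) = lam.omega N x) : lam.IsCotensorable := by
  have key : ∀ N : RComod C, ∃ (t : Tens A N (Tens A C M) →ₗ[Bᵐᵒᵖ] Tens A N M)
      (p : Tens A N M →ₗ[Bᵐᵒᵖ] lam.cotensor N),
      p ∘ₗ lam.incl N = LinearMap.id ∧
        lam.incl N ∘ₗ p = LinearMap.id - t ∘ₗ lam.omega N := fun N => by
    obtain ⟨t, ht⟩ := hω N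
    refine ⟨t, LinearMap.codRestrict _ (LinearMap.id - t ∘ₗ lam.omega N) fun x => ?_, ?_, ?_⟩
    · change lam.omega N (x - t (lam.omega N x)) = 0
      rw [map_sub, ht, sub_self]
    · refine LinearMap.ext fun x => Subtype.ext ?_
      have : lam.omega N x = 0 := x.2
      change (x : Tens A N M) - t (lam.omega N x) = x
      rw [this, map_zero, sub_zero]
    · rfl
  have inj : ∀ (L : Type u) [AddCommGroup L] [Module B L] (N : RComod C),
      Function.Injective (Tens.map (lam.incl N) (LinearMap.id (R := B) (M := L))) := by
    intro L _ _ N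
    obtain ⟨t, p, hp, -⟩ := key N
    have : ∀ z, Tens.map p (LinearMap.id (R := B) (M := L))
        (Tens.map (lam.incl N) (LinearMap.id (R := B) (M := L)) z) = z := fun z => by
      rw [← Tens.map_comp_left, hp, Tens.map_id]
    exact Function.LeftInverse.injective this
  refine ⟨inj D, fun N x hx => ?_, inj _⟩
  obtain ⟨t, p, -, hp⟩ := key N
  refine ⟨Tens.map p (LinearMap.id (R := B)) x, ?_⟩
  rw [← Tens.map_comp_left, hp, Tens.map_sub_left, Tens.map_id, Tens.map_comp_left, hx, map_zero,
    sub_zero]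

end Comparison

/-! ### Coseparable corings -/

/-- `X ⊗ g` for a bimodule homomorphism `g`, as a homomorphism of right modules. -/
def BimodHom.tensLeft {S X M N : Type*} [Ring S] [AddCommGroup X] [Module Aᵐᵒᵖ X] [AddCommGroup M]
    [Module A M] [Module Sᵐᵒᵖ M] [SMulCommClass A Sᵐᵒᵖ M] [AddCommGroup N] [Module A N]
    [Module Sᵐᵒᵖ N] [SMulCommClass A Sᵐᵒᵖ N] (g : BimodHom A S M N) :
    Tens A X M →ₗ[Sᵐᵒᵖ] Tens A X N where
  toFun := Tens.map (LinearMap.id (R := Aᵐᵒᵖ)) g.left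
  map_add' := map_add _
  map_smul' s z := by
    induction z using Tens.induction_on with
    | zero => simp
    | tmul x m => exact congrArg (Tens.tmul A x) (g.map_right_smul s.unop m)
    | add x y hx hy => simp only [smul_add, map_add, hx, hy]

theorem Tens.hom_ext_three {B M N L P : Type*} [Ring B] [AddCommGroup M] [Module Aᵐᵒᵖ M]
    [AddCommGroup N] [Module A N] [Module Bᵐᵒᵖ N] [SMulCommClass A Bᵐᵒᵖ N] [AddCommGroup L]
    [Module B L] [AddCommGroup P] {f g : Tens B (Tens A M N) L →+ P}
    (h : ∀ m n l, f (Tens.tmul B (Tens.tmul A m n) l) = g (Tens.tmul B (Tens.tmul A m n) l)) :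
    f = g := by
  refine Tens.hom_ext fun w l => ?_
  induction w using Tens.induction_on with
  | zero => simp
  | tmul m n => exact h m n l
  | add x y hx hy => simp only [Tens.add_tmul, map_add, hx, hy]

section Coseparable

variable (γ : BimodHom A A (Tens A C C) C)
  (hγ : ∀ x, C.comul (γ x) = Tens.map γ.right (LinearMap.id (R := A))
      (Tens.assoc.symm (Tens.map (LinearMap.id (R := Aᵐᵒᵖ)) C.comul.left x)))

/-- The map `X ⊗ γ : X ⊗_A C ⊗_A C → X ⊗_A C`. -/
def tensGamma (X : Type u) [AddCommGroup X] [Module Aᵐᵒᵖ X] :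
    Tens A (Tens A X C) C →ₗ[Aᵐᵒᵖ] Tens A X C :=
  γ.tensLeft ∘ₗ Tens.assocRight

theorem tensGamma_natural {X Y : Type u} [AddCommGroup X] [Module Aᵐᵒᵖ X] [AddCommGroup Y]
    [Module Aᵐᵒᵖ Y] (f : X →ₗ[Aᵐᵒᵖ] Y) (g : Tens A X C →ₗ[Aᵐᵒᵖ] Tens A Y C)
    (hg : ∀ z, g z = Tens.map f (LinearMap.id (R := A)) z) (z : Tens A (Tens A X C) C) :
    Tens.map f (LinearMap.id (R := A)) (tensGamma γ X z) =
      tensGamma γ Y (Tens.map g (LinearMap.id (R := A)) z) := by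
  have : (Tens.map f (LinearMap.id (R := A))).comp (tensGamma γ X).toAddMonoidHom =
      (tensGamma γ Y).toAddMonoidHom.comp (Tens.map g (LinearMap.id (R := A) (M := C))) :=
    Tens.hom_ext_three fun x c d => by
      change _ = tensGamma γ Y (Tens.tmul A (g (Tens.tmul A x c)) d)
      rw [hg]
      rfl
  exact DFunLike.congr_fun this z

/-- `X ⊗ γ` as a morphism of right comodules, by the right colinearity of `γ`. -/
def tensGammaHom (X : Type u) [AddCommGroup X] [Module Aᵐᵒᵖ X] :
    C.regular.tens (Tens A X C) ⟶ C.regular.tens X where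
  lin := tensGamma γ X
  comm z := by
    have : (Tens.map (tensGamma γ X) (LinearMap.id (R := A) (M := C))).comp
          (LRComod.tensCoact (Tens A X C) C.regular).toAddMonoidHom =
        (LRComod.tensCoact X C.regular).toAddMonoidHom.comp (tensGamma γ X).toAddMonoidHom :=
      Tens.hom_ext_three fun x c (d : C) => by
        change Tens.map (tensGamma γ X) (LinearMap.id (R := A))
            (Tens.assoc.symm (Tens.tmul A (Tens.tmul A x c) (C.comul d))) =
          Tens.assoc.symm (Tens.tmul A x (C.comul (γ (Tens.tmul A c d))))
        rw [hγ]
        change _ = Tens.assoc.symm (Tens.tmul A x (Tens.map γ.right (LinearMap.id (R := A))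
          (Tens.assoc.symm (Tens.tmul A c (C.comul d)))))
        induction C.comul d using Tens.induction_on with
        | zero => simp
        | tmul d e => rfl
        | add x y hx hy => simp only [Tens.tmul_add, map_add, hx, hy]
    exact DFunLike.congr_fun this z

variable
  (hγ' : ∀ x, C.comul (γ x) = Tens.map (LinearMap.id (R := Aᵐᵒᵖ)) γ.left
      (Tens.assoc (Tens.map C.comul.right (LinearMap.id (R := A)) x)))
include hγ'

/-- `(N ⊗ Δ)(N ⊗ γ) = (N ⊗ C ⊗ γ)(N ⊗ Δ ⊗ C)`, by the left colinearity of `γ`. -/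
theorem tensCoact_tensGamma (N : RComod C) (z : Tens A (Tens A N C) C) :
    LRComod.tensCoact N C.regular (tensGamma γ N z) = tensGamma γ (Tens A N C)
      (Tens.map (LRComod.tensCoact N C.regular) (LinearMap.id (R := A)) z) := by
  have : (LRComod.tensCoact N C.regular).toAddMonoidHom.comp (tensGamma γ N).toAddMonoidHom =
      (tensGamma γ (Tens A N C)).toAddMonoidHom.comp
        (Tens.map (LRComod.tensCoact N C.regular) (LinearMap.id (R := A) (M := C))) :=
    Tens.hom_ext_three fun x c d => by
      change Tens.assoc.symm (Tens.tmul A x (C.comul (γ (Tens.tmul A c d)))) =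
        tensGamma γ (Tens A N C)
          (Tens.tmul A (Tens.assoc.symm (Tens.tmul A x (C.comul c))) d)
      rw [hγ', Tens.map_tmul]
      change Tens.assoc.symm (Tens.tmul A x (Tens.map (LinearMap.id (R := Aᵐᵒᵖ)) γ.left
        (Tens.assoc (Tens.tmul A (C.comul c) d)))) = _
      induction C.comul c using Tens.induction_on with
      | zero => simp
      | tmul d e => rfl
      | add x y hx hy => simp only [Tens.tmul_add, Tens.add_tmul, map_add, hx, hy]
  exact DFunLike.congr_fun this z

/-- The map `(N ⊗ γ)(ρ_N ⊗ C)` takes its values in the kernel of `ρ_N ⊗ C - N ⊗ Δ`, which is the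
image of `ρ_N`. -/
theorem omegaC_tensGamma (N : RComod C) (z : Tens A N C) :
    N.omegaC.lin (tensGamma γ N (Tens.map N.coact (LinearMap.id (R := A)) z)) = 0 := by
  change (N.coactTens - N.tensComul).lin _ = 0
  rw [RComod.sub_lin]
  refine sub_eq_zero.2 ?_
  refine (tensGamma_natural γ N.coact N.coactTens.lin (fun _ => rfl) _).trans
    (Eq.trans ?_ (tensCoact_tensGamma γ hγ' N _).symm)
  refine congrArg (tensGamma γ (Tens A N C)) ?_
  let f : Tens A N C →ₗ[Aᵐᵒᵖ] Tens A (Tens A N C) C := N.coactTens.lin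
  have e : f ∘ₗ N.coact = LRComod.tensCoact N C.regular ∘ₗ N.coact :=
    LinearMap.ext N.coactHom.comm
  refine (Tens.map_comp_left N.coact f z).symm.trans ?_
  rw [e]
  exact Tens.map_comp_left N.coact (LRComod.tensCoact N C.regular) z

end Coseparable

/-- Over a coseparable coring, the fork formed by `ρ_N` and `ρ_N ⊗ C - N ⊗ Δ` splits in the category
of comodules. -/
theorem Coring.IsCoseparable.exists_splitting (hC : C.IsCoseparable) (N : RComod C) :
    ∃ (r : C.regular.tens N ⟶ N) (t : C.regular.tens (Tens A N C) ⟶ C.regular.tens N),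
      N.coactHom ≫ r = 𝟙 N ∧ N.omegaC ≫ t = r ≫ N.coactHom - 𝟙 _ := by
  obtain ⟨γ, hγΔ, hγ, hγ'⟩ := hC
  let t := tensGammaHom γ hγ N
  have hρ : ∀ z : Tens A N C, N.coact (N.counitLin ((N.coactTens ≫ t).lin z)) =
      (N.coactTens ≫ t).lin z := fun z => N.coact_counitLin _ (omegaC_tensGamma γ hγ' N z)
  let r : C.regular.tens N ⟶ N := RComod.liftOfInjective N.coactHom N.map_coact_injective
    (N.counitLin ∘ₗ (N.coactTens ≫ t).lin) (N.coactTens ≫ t) hρ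
  have hr : r ≫ N.coactHom = N.coactTens ≫ t := RComod.hom_ext hρ
  have ht : N.tensComul ≫ t = 𝟙 _ := LRComod.tens_hom_ext fun n c => by
    change Tens.map (LinearMap.id (R := Aᵐᵒᵖ)) γ.left (Tens.assoc (Tens.assoc.symm
      (Tens.tmul A n (C.comul c)))) = Tens.tmul A n c
    rw [AddEquiv.apply_symm_apply, Tens.map_tmul]
    exact congrArg (Tens.tmul A n) (hγΔ c)
  have hω : N.coactHom ≫ N.coactTens = N.coactHom ≫ N.tensComul := by
    have := N.coactHom_omegaC
    rwa [RComod.omegaC, Preadditive.comp_sub, sub_eq_zero] at this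
  refine ⟨r, t, ?_, ?_⟩
  · have : (N.coactHom ≫ r) ≫ N.coactHom = N.coactHom := by
      rw [Category.assoc, hr, ← Category.assoc, hω, Category.assoc, ht, Category.comp_id]
    refine RComod.hom_ext fun n => ?_
    refine (N.counitLin_coact _).symm.trans (Eq.trans (congrArg N.counitLin ?_)
      (N.counitLin_coact n))
    exact congrArg (fun f : N ⟶ C.regular.tens N => f.lin n) this
  · rw [hr, RComod.omegaC, Preadditive.sub_comp, ht]

section

variable {B : Type u} [Ring B] [Algebra k B] {D : Coring k B}
variable (F : RComod C ⥤ RComod D) [F.Additive]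

/-- Every additive functor preserves the kernel `ρ_N` if the coring is coseparable. -/
theorem Coring.IsCoseparable.nonempty_isLimit_map (hC : C.IsCoseparable) (N : RComod C) :
    Nonempty (IsLimit (KernelFork.ofι (F.map N.coactHom) (N.map_coactHom_omegaC F))) := by
  obtain ⟨r, t, hr, ht⟩ := hC.exists_splitting N
  refine ⟨Fork.IsLimit.mk _ (fun s => s.ι ≫ F.map r) (fun s => ?_) (fun s m hm => ?_)⟩
  · have h : s.ι ≫ F.map N.omegaC = 0 := KernelFork.condition s
    have h' := congrArg (fun f => s.ι ≫ F.map f) ht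
    simp only [F.map_comp, F.map_sub, Preadditive.comp_sub, F.map_id, Category.comp_id] at h'
    rw [← Category.assoc, h, zero_comp] at h'
    refine (Category.assoc _ _ _).trans ?_
    exact (sub_eq_zero.1 h'.symm)
  · have hm' : m ≫ F.map N.coactHom = s.ι := hm
    rw [← hm', Category.assoc, ← F.map_comp, hr, F.map_id]
    exact (Category.comp_id m).symm

variable [F.Linear k]

/-- Over a coseparable coring, `F(C)` satisfies the purity condition. -/
theorem Coring.IsCoseparable.isCotensorable (hC : C.IsCoseparable) (hU : UpsilonIso F)
    {lam : LeftCoaction C (C.regular.mapFunctor F)}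
    (hlam : ∀ (N : RComod C) (x : Tens A N (C.regular.mapFunctor F)),
      (upsilon F (Tens A N C) C.regular).lin (Tens.assoc.symm (lam.omega N x)) =
        (F.map N.omegaC).lin ((upsilon F N C.regular).lin x)) : lam.IsCotensorable := by
  refine lam.isCotensorable_of_regular fun N => ?_
  obtain ⟨r, t, -, ht⟩ := hC.exists_splitting N
  have := (hU N).1
  have := (hU N).2
  let e : Tens A (Tens A N C) (C.regular.mapFunctor F) ≃ₗ[Bᵐᵒᵖ]
      Tens A N (Tens A C (C.regular.mapFunctor F)) :=
    LinearEquiv.ofBijective Tens.assocRight Tens.assoc.bijective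
  have he : ∀ z, e.symm z = Tens.assoc.symm z := fun z => by
    rw [LinearEquiv.symm_apply_eq]
    exact (AddEquiv.apply_symm_apply Tens.assoc z).symm
  -- `F(-t)`, transported along `Υ`, is the quasi-inverse of `ω_N`
  let s : (C.regular.mapFunctor F).tens (Tens A N C) ⟶ (C.regular.mapFunctor F).tens N :=
    upsilon F (Tens A N C) C.regular ≫ F.map (-t) ≫ inv (upsilon F N C.regular)
  have hω : N.omegaC ≫ (-t) ≫ N.omegaC = N.omegaC := by
    rw [← Category.assoc, Preadditive.comp_neg, ht, Preadditive.neg_comp, Preadditive.sub_comp,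
      Category.assoc, N.coactHom_omegaC, comp_zero, zero_sub, neg_neg, Category.id_comp]
  refine ⟨s.lin ∘ₗ e.symm.toLinearMap, fun x => ?_⟩
  apply Tens.assoc.symm.injective
  apply RComod.lin_injective_of_isIso (upsilon F (Tens A N C) C.regular)
  refine (hlam N _).trans (Eq.trans ?_ (hlam N x).symm)
  change (F.map N.omegaC).lin ((upsilon F N C.regular).lin ((inv (upsilon F N C.regular)).lin
    ((F.map (-t)).lin ((upsilon F (Tens A N C) C.regular).lin (e.symm (lam.omega N x)))))) = _
  rw [RComod.lin_inv_apply, he]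
  refine (congrArg (fun y => (F.map N.omegaC).lin ((F.map (-t)).lin y)) (hlam N x)).trans ?_
  have h := congrArg F.map hω
  rw [F.map_comp, F.map_comp] at h
  exact congrArg (fun f : F.obj (C.regular.tens N) ⟶ _ => f.lin ((upsilon F N C.regular).lin x)) h

end

/-! ### The representation of `F` -/

section Representation

variable {B : Type u} [Ring B] [Algebra k B] {D : Coring k B}

/-- The representation theorem, given that `Υ` is an isomorphism where it is needed. -/
theorem exists_leftCoaction_iso_cotensor (F : RComod C ⥤ RComod D) [F.Additive] [F.Linear k]
    (hU : UpsilonIso F)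
    (h : (IsFlatLeft B D ∧ ∀ N : RComod C, PreservesLimit (parallelPair N.omegaC 0) F) ∨
      C.IsCoseparable) :
    ∃ lam : LeftCoaction C (C.regular.mapFunctor F),
      (∀ y : C.regular.mapFunctor F,
        (upsilon F C C.regular).lin (lam.coact y) = (F.map C.comulHom).lin y) ∧
      ∃ h : lam.IsCotensorable, Nonempty (F ≅ h.functor) := by
  have h₁ : IsIso (upsilon F C C.regular) := (hU C.regular.toRComod).1
  have h₂ : IsIso (upsilon F (Tens A C C) C.regular) := (hU C.regular.toRComod).2
  refine ⟨leftCoactionOfUpsilon F, upsilon_upsilonCoact F, ?_⟩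
  rcases h with ⟨hD, hF⟩ | hC
  · refine ⟨LeftCoaction.isCotensorable_of_flat _ hD,
      nonempty_iso_cotensor hU (upsilon_omega F) _ fun N => ?_⟩
    have := hF N
    exact ⟨isLimitForkMapOfIsLimit' F _ N.coactIsLimit⟩
  · exact ⟨hC.isCotensorable F hU (upsilon_omega F),
      nonempty_iso_cotensor hU (upsilon_omega F) _ (hC.nonempty_isLimit_map F)⟩

end Representation

/-! ### Adjunction for the tensor functor -/

section TensorFunctor

variable {T : Type u} [Ring T] [Algebra k T]

namespace LRComod

/-- The group of comodule morphisms `M → P`, regarded as a right `T`-module by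
`(f · t)(m) = f(t m)`. It is a type synonym because the morphisms already carry a `k`-module
structure. -/
def HomMod (M : LRComod T C) (P : RComod C) : Type u := M.toRComod ⟶ P

instance (M : LRComod T C) (P : RComod C) : AddCommGroup (M.HomMod P) :=
  inferInstanceAs (AddCommGroup (M.toRComod ⟶ P))

instance (M : LRComod T C) (P : RComod C) : Module Tᵐᵒᵖ (M.HomMod P) where
  smul t f := (M.act t.unop ≫ f : M.toRComod ⟶ P)
  one_smul f := RComod.hom_ext fun m => by
    change f.lin ((1 : T) • m) = f.lin m
    rw [one_smul]
  mul_smul s t f := RComod.hom_ext fun m => by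
    change f.lin ((t.unop * s.unop) • m) = f.lin (t.unop • s.unop • m)
    rw [mul_smul]
  smul_zero t := Limits.comp_zero (f := M.act t.unop)
  smul_add t f g := Preadditive.comp_add _ _ _ (M.act t.unop) f g
  add_smul s t f := RComod.hom_ext fun m => by
    change f.lin ((s.unop + t.unop) • m) = f.lin (s.unop • m) + f.lin (t.unop • m)
    rw [add_smul, map_add]
  zero_smul f := RComod.hom_ext fun m => by
    change f.lin ((0 : T) • m) = 0
    rw [zero_smul, map_zero]

/-- The functor `Hom(M, -)` from right comodules to right `T`-modules. -/
def homFunctor (M : LRComod T C) : RComod C ⥤ ModuleCat.{u} Tᵐᵒᵖ where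
  obj P := ModuleCat.of Tᵐᵒᵖ (M.HomMod P)
  map {P Q} f := ModuleCat.ofHom
    { toFun := fun g => (g ≫ f : M.toRComod ⟶ Q)
      map_add' := fun g g' => Preadditive.add_comp _ _ _ g g' f
      map_smul' := fun t g => Category.assoc (M.act t.unop) g f }
  map_id P := by
    ext g
    exact Category.comp_id (X := M.toRComod) g
  map_comp f f' := by
    ext g
    exact (Category.assoc (W := M.toRComod) g f f').symm

/-- The functor `- ⊗_T M` from right `T`-modules to right comodules. -/
def tensFunctor (M : LRComod T C) : ModuleCat.{u} Tᵐᵒᵖ ⥤ RComod C where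
  obj X := M.tens X
  map f := M.tensMap f.hom
  map_id _ := tens_hom_ext fun _ _ => rfl
  map_comp _ _ := tens_hom_ext fun _ _ => rfl

/-- The morphism `X ⊗_T M → P` that corresponds to `X → Hom(M, P)`. -/
def uncurry (M : LRComod T C) {X : Type u} [AddCommGroup X] [Module Tᵐᵒᵖ X] {P : RComod C}
    (g : X →ₗ[Tᵐᵒᵖ] M.HomMod P) : M.tens X ⟶ P :=
  tensDesc X M P
    (Tens.lift (fun x m => RComod.Hom.lin (show M.toRComod ⟶ P from g x) m)
      (fun x y m => by rw [map_add]; rfl)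
      (fun x m n => map_add _ m n)
      (fun t x m => by rw [map_smul]; rfl))
    (fun a x m => map_smul (RComod.Hom.lin (show M.toRComod ⟶ P from g x)) a m)
    (fun L hL x m => by
      let f : M.toRComod ⟶ P := g x
      let i : M →ₗ[Aᵐᵒᵖ] Tens T X M := (M.insert X x).lin
      have e : L ∘ₗ i = f.lin := LinearMap.ext fun m => hL _
      rw [Tens.assoc_symm_tmul_eq_map x i (fun _ => rfl), ← Tens.map_comp_left, e]
      exact f.comm m)

/-- `- ⊗_T M` is left adjoint to `Hom(M, -)`. -/
def tensHomAdjunction (M : LRComod T C) : M.tensFunctor ⊣ M.homFunctor :=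
  Adjunction.mkOfHomEquiv
    { homEquiv := fun X P =>
        { toFun := fun f => ModuleCat.ofHom
            { toFun := fun x => (M.insert X x ≫ f : M.toRComod ⟶ P)
              map_add' := fun x y => RComod.hom_ext fun m =>
                (congrArg f.lin (Tens.add_tmul x y m)).trans (map_add f.lin _ _)
              map_smul' := fun t x => RComod.hom_ext fun m =>
                congrArg f.lin (Tens.smul_tmul t.unop x m) }
          invFun := fun g => M.uncurry g.hom
          left_inv := fun f => tens_hom_ext fun x m => rfl
          right_inv := fun g => by
            ext x
            rfl }
      homEquiv_naturality_left_symm := fun f g => tens_hom_ext fun x m => rfl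
      homEquiv_naturality_right := fun f g => by
        ext x
        rfl }

instance (M : LRComod T C) : M.tensFunctor.IsLeftAdjoint := M.tensHomAdjunction.isLeftAdjoint

theorem sum_tensMap_comp (M : LRComod T C) {X : Type u} [AddCommGroup X] [Module Tᵐᵒᵖ X]
    {ι : Type*} [Fintype ι] {Y : ι → Type u} [∀ s, AddCommGroup (Y s)] [∀ s, Module Tᵐᵒᵖ (Y s)]
    (i : ∀ s, Y s →ₗ[Tᵐᵒᵖ] X) (p : ∀ s, X →ₗ[Tᵐᵒᵖ] Y s)
    (hip : ∑ s, i s ∘ₗ p s = LinearMap.id) :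
    ∑ s, M.tensMap (p s) ≫ M.tensMap (i s) = 𝟙 (M.tens X) := by
  refine RComod.hom_ext fun z => ?_
  let ev : (M.tens X ⟶ M.tens X) →+ M.tens X :=
    { toFun := fun f => f.lin z
      map_zero' := rfl
      map_add' := fun _ _ => rfl }
  refine (map_sum ev _ _).trans ?_
  have h : ∀ s, ev (M.tensMap (p s) ≫ M.tensMap (i s)) =
      Tens.map (i s ∘ₗ p s) (LinearMap.id (R := T)) z := fun s =>
    (Tens.map_comp_left (p s) (i s) z).symm
  rw [Finset.sum_congr rfl fun s _ => h s]
  refine (Tens.map_sum_left Finset.univ (fun s => i s ∘ₗ p s) _ z).symm.trans ?_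
  rw [hip]
  exact Tens.map_id z

theorem isIso_unitHom (M : LRComod T C) : IsIso M.unitHom := by
  refine ⟨M.insert T 1, tens_hom_ext fun t m => ?_, RComod.hom_ext fun m => one_smul T m⟩
  change Tens.tmul T 1 (t • m) = Tens.tmul T t m
  rw [← Tens.smul_tmul]
  simp

end LRComod

/-! ### Closure properties of the modules at which `Υ` is an isomorphism -/

variable {B : Type u} [Ring B] [Algebra k B] {D : Coring k B}
variable (F : RComod C ⥤ RComod D) [F.Additive] [F.Linear k]

/-- `Υ_{-,M}` as a natural transformation. -/
def upsilonTrans (M : LRComod T C) : (M.mapFunctor F).tensFunctor ⟶ M.tensFunctor ⋙ F where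
  app X := upsilon F X M
  naturality _ Y f := upsilon_natural F _ M (Y := Y) f.hom

/-- The modules at which `Υ` is an isomorphism are closed under the colimits that `F` preserves. -/
theorem isIso_upsilon_of_isColimit (M : LRComod T C) {J : Type w} [Category.{w'} J]
    [PreservesColimitsOfShape J F] {K : J ⥤ ModuleCat.{u} Tᵐᵒᵖ} {c : Cocone K} (hc : IsColimit c)
    (h : ∀ j, IsIso (upsilon F (K.obj j) M)) : IsIso (upsilon F c.pt M) := by
  let α : K ⋙ (M.mapFunctor F).tensFunctor ⟶ K ⋙ M.tensFunctor ⋙ F :=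
    Functor.whiskerLeft K (upsilonTrans F M)
  have : ∀ j, IsIso (α.app j) := h
  have : IsIso α := NatIso.isIso_of_isIso_app α
  let h₁ := isColimitOfPreserves (M.mapFunctor F).tensFunctor hc
  let h₂ := isColimitOfPreserves (M.tensFunctor ⋙ F) hc
  have e : (h₁.coconePointsIsoOfNatIso h₂ (asIso α)).hom = (upsilonTrans F M).app c.pt :=
    h₁.hom_ext fun j =>
      (h₁.comp_coconePointsIsoOfNatIso_hom h₂ (asIso α) j).trans
        ((upsilonTrans F M).naturality (c.ι.app j)).symm
  have : IsIso ((upsilonTrans F M).app c.pt) := e ▸ inferInstance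
  exact this

/-- `Υ` is an isomorphism at `X` if the identity of `X` is a finite sum of endomorphisms that factor
through modules at which `Υ` is an isomorphism. -/
theorem isIso_upsilon_of_sum (M : LRComod T C) {X : Type u} [AddCommGroup X] [Module Tᵐᵒᵖ X]
    {ι : Type*} [Fintype ι] (Y : ι → Type u) [∀ s, AddCommGroup (Y s)] [∀ s, Module Tᵐᵒᵖ (Y s)]
    (i : ∀ s, Y s →ₗ[Tᵐᵒᵖ] X) (p : ∀ s, X →ₗ[Tᵐᵒᵖ] Y s)
    (hip : ∑ s, i s ∘ₗ p s = LinearMap.id) (h : ∀ s, IsIso (upsilon F (Y s) M)) :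
    IsIso (upsilon F X M) := by
  have key := M.sum_tensMap_comp i p hip
  have key' := (M.mapFunctor F).sum_tensMap_comp i p hip
  refine ⟨∑ s, F.map (M.tensMap (p s)) ≫ inv (upsilon F (Y s) M) ≫
    (M.mapFunctor F).tensMap (i s), ?_, ?_⟩
  · rw [Preadditive.comp_sum, ← key']
    refine Finset.sum_congr rfl fun s _ => ?_
    rw [← Category.assoc, ← upsilon_natural, Category.assoc, IsIso.hom_inv_id_assoc]
  · rw [Preadditive.sum_comp, ← F.map_id, ← key, F.map_sum]
    refine Finset.sum_congr rfl fun s _ => ?_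
    rw [Category.assoc, Category.assoc, upsilon_natural, IsIso.inv_hom_id_assoc, F.map_comp]

theorem isIso_upsilon_unit (M : LRComod T C) : IsIso (upsilon F T M) := by
  have h₁ := M.isIso_unitHom
  have h₂ : IsIso (upsilon F T M ≫ F.map M.unitHom) :=
    (upsilon_unit F M).symm ▸ (M.mapFunctor F).isIso_unitHom
  exact IsIso.of_isIso_comp_right _ (F.map M.unitHom)

end TensorFunctor

/-! ### Modules over von Neumann regular rings -/

section Regular

variable {R : Type*} [Ring R] {P Q : Type*} [AddCommGroup P] [Module R P] [AddCommGroup Q]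
  [Module R Q]

/-- A linear map `f` is regular if it has a quasi-inverse `g`, that is, `f g f = f`. -/
def LinearMap.HasQuasiInverse (f : P →ₗ[R] Q) : Prop := ∃ g : Q →ₗ[R] P, f ∘ₗ g ∘ₗ f = f

/-- The Brown–McCoy lemma: if `u = f - f g f` has the quasi-inverse `h`, then
`g + (1 - g f) h (1 - f g)` is a quasi-inverse of `f`. -/
theorem LinearMap.HasQuasiInverse.of_sub {f : P →ₗ[R] Q} (g : Q →ₗ[R] P)
    (h : (f - f ∘ₗ g ∘ₗ f).HasQuasiInverse) : f.HasQuasiInverse := by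
  obtain ⟨h, hh⟩ := h
  refine ⟨g + (LinearMap.id - g ∘ₗ f) ∘ₗ h ∘ₗ (LinearMap.id - f ∘ₗ g), LinearMap.ext fun x => ?_⟩
  have := LinearMap.congr_fun hh x
  simp only [LinearMap.comp_apply, LinearMap.sub_apply, map_sub] at this
  simp only [LinearMap.comp_apply, LinearMap.add_apply, LinearMap.sub_apply, LinearMap.id_apply,
    map_add, map_sub]
  rw [this]
  abel

/-- Over a von Neumann regular ring, a single coordinate of an element of a free module can be
cleared by subtracting `f g f`; induction on the support then yields a quasi-inverse. -/
theorem LinearMap.hasQuasiInverse_finsupp (hR : ∀ a : R, ∃ b : R, a * b * a = a) {ι : Type*}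
    (f : R →ₗ[R] ι →₀ R) : f.HasQuasiInverse := by
  classical
  suffices ∀ (s : Finset ι) (f : R →ₗ[R] ι →₀ R), (∀ i ∉ s, f 1 i = 0) → f.HasQuasiInverse from
    this (f 1).support f fun i hi => Finsupp.notMem_support_iff.1 hi
  intro s
  induction s using Finset.induction_on with
  | empty =>
    intro f hf
    have : f = 0 := LinearMap.ext_ring (Finsupp.ext fun i => hf i (by simp))
    exact ⟨0, by simp [this]⟩
  | insert a s _ ih =>
    intro f hf
    obtain ⟨b, hb⟩ := hR (f 1 a)
    let g : (ι →₀ R) →ₗ[R] R := LinearMap.toSpanSingleton R R b ∘ₗ Finsupp.lapply a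
    refine .of_sub g (ih _ fun i hi => ?_)
    have e : (f - f ∘ₗ g ∘ₗ f) 1 = f 1 - (f 1 a * b) • f 1 := by
      rw [← map_smul, smul_eq_mul, mul_one]
      rfl
    rw [e, Finsupp.sub_apply, Finsupp.smul_apply, smul_eq_mul]
    by_cases hia : i = a
    · rw [hia, hb, sub_self]
    · rw [hf i (by simp [hia, hi]), mul_zero, sub_zero]

/-- A map from a finite free module to `Q` has a quasi-inverse if each map `R → Q` has one: columns
are cleared one at a time. -/
theorem LinearMap.hasQuasiInverse_of_forall (hQ : ∀ f : R →ₗ[R] Q, f.HasQuasiInverse) {ι : Type*}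
    [Finite ι] (f : (ι →₀ R) →ₗ[R] Q) : f.HasQuasiInverse := by
  classical
  have := Fintype.ofFinite ι
  suffices ∀ (s : Finset ι) (f : (ι →₀ R) →ₗ[R] Q),
      (∀ i ∉ s, f ∘ₗ Finsupp.lsingle i = 0) → f.HasQuasiInverse from
    this Finset.univ f fun i hi => absurd (Finset.mem_univ i) hi
  intro s
  induction s using Finset.induction_on with
  | empty =>
    intro f hf
    have : f = 0 := Finsupp.lhom_ext' fun i => (hf i (by simp)).trans (LinearMap.zero_comp _).symm
    exact ⟨0, by simp [this]⟩
  | insert a s _ ih =>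
    intro f hf
    obtain ⟨h, hh⟩ := hQ (f ∘ₗ Finsupp.lsingle a)
    refine .of_sub (Finsupp.lsingle a ∘ₗ h) (ih _ fun i hi => ?_)
    refine LinearMap.ext fun x => ?_
    by_cases hia : i = a
    · subst hia
      exact sub_eq_zero.2 (LinearMap.congr_fun hh x).symm
    · have : f (Finsupp.lsingle i x) = 0 :=
        LinearMap.congr_fun (hf i (by simp [hia, hi])) x
      change f (Finsupp.lsingle i x) -
        f ((Finsupp.lsingle a : R →ₗ[R] ι →₀ R) (h (f (Finsupp.lsingle i x)))) = 0
      rw [this]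
      simp

/-- Over a von Neumann regular ring, a finitely generated submodule of a free module is a direct
summand. -/
theorem Submodule.exists_mkQ_section (hR : ∀ a : R, ∃ b : R, a * b * a = a) {ι : Type*}
    (K : Submodule R (ι →₀ R)) (hK : K.FG) :
    ∃ s : ((ι →₀ R) ⧸ K) →ₗ[R] ι →₀ R, K.mkQ ∘ₗ s = LinearMap.id := by
  obtain ⟨S, rfl⟩ := hK
  let f : (S →₀ R) →ₗ[R] ι →₀ R := Finsupp.linearCombination R Subtype.val
  have hf : LinearMap.range f = span R (S : Set (ι →₀ R)) := by
    rw [Finsupp.range_linearCombination, Subtype.range_val]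
  obtain ⟨g, hg⟩ := f.hasQuasiInverse_of_forall (LinearMap.hasQuasiInverse_finsupp hR)
  -- `f g` is a projection onto `range f = K`
  refine ⟨liftQ _ (LinearMap.id - f ∘ₗ g) fun x hx => ?_,
    linearMap_qext _ (LinearMap.ext fun x => ?_)⟩
  · rw [← hf] at hx
    obtain ⟨y, rfl⟩ := hx
    exact sub_eq_zero.2 (LinearMap.congr_fun hg y).symm
  · change mkQ _ (x - f (g x)) = mkQ _ x
    rw [map_sub, sub_eq_self, mkQ_apply, Quotient.mk_eq_zero, ← hf]
    exact ⟨_, rfl⟩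

end Regular

/-! ### Flatness over von Neumann regular rings -/

section Flat

variable {A : Type u} [Ring A]

theorem IsVonNeumannRegular.mulOpposite (hA : IsVonNeumannRegular A) (a : Aᵐᵒᵖ) :
    ∃ b : Aᵐᵒᵖ, a * b * a = a := by
  obtain ⟨b, hb⟩ := hA a.unop
  exact ⟨op b, unop_injective (by simpa [mul_assoc] using hb)⟩

variable {X Y : Type u} [AddCommGroup X] [Module A X] [AddCommGroup Y] [Module A Y]

/-- The ring `A`, as a right module over itself, in terms of its opposite ring. -/
def opRightEquiv (A : Type*) [Ring A] : Aᵐᵒᵖ ≃ₗ[Aᵐᵒᵖ] A where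
  toFun := unop
  invFun := op
  map_add' _ _ := rfl
  map_smul' _ _ := rfl

theorem Tens.map_injective_op (f : X →ₗ[A] Y) (hf : Function.Injective f) :
    Function.Injective (Tens.map (LinearMap.id (R := Aᵐᵒᵖ) (M := Aᵐᵒᵖ)) f) := by
  have he : ∀ z : Tens A Aᵐᵒᵖ X, Tens.map (opRightEquiv A).symm.toLinearMap (LinearMap.id (R := A))
      (Tens.map (opRightEquiv A).toLinearMap (LinearMap.id (R := A)) z) = z := fun z => by
    rw [← Tens.map_comp_left, LinearEquiv.symm_comp]
    exact Tens.map_id z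
  have hef : ∀ z : Tens A Aᵐᵒᵖ X,
      Tens.lid (Tens.map (opRightEquiv A).toLinearMap (LinearMap.id (R := A))
        (Tens.map (LinearMap.id (R := Aᵐᵒᵖ)) f z)) =
      f (Tens.lid (Tens.map (opRightEquiv A).toLinearMap (LinearMap.id (R := A)) z)) := fun z => by
    induction z using Tens.induction_on with
    | zero => simp
    | tmul a x => exact (map_smul f a.unop x).symm
    | add x y hx hy => simp only [map_add, hx, hy]
  intro x y hxy
  refine Function.LeftInverse.injective he (Tens.lid_injective (hf ?_))
  rw [← hef, ← hef, hxy]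

/-- Free right modules are flat. -/
theorem Tens.map_injective_finsupp {ι : Type u} (f : X →ₗ[A] Y) (hf : Function.Injective f) :
    Function.Injective (Tens.map (LinearMap.id (R := Aᵐᵒᵖ) (M := ι →₀ Aᵐᵒᵖ)) f) := by
  classical
  let p (s : Finset ι) : (ι →₀ Aᵐᵒᵖ) →ₗ[Aᵐᵒᵖ] ι →₀ Aᵐᵒᵖ :=
    ∑ i ∈ s, Finsupp.lsingle i ∘ₗ Finsupp.lapply i
  have hp : ∀ (s : Finset ι) (v : ι →₀ Aᵐᵒᵖ), v.support ⊆ s → p s v = v := fun s v hv => by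
    simp only [p, LinearMap.sum_apply, LinearMap.comp_apply, Finsupp.lsingle_apply,
      Finsupp.lapply_apply]
    exact (Finsupp.sum_of_support_subset v hv _ (by simp)).symm.trans v.sum_single
  -- each tensor lives on finitely many coordinates, so it vanishes if all its coordinates do
  have hs : ∀ z : Tens A (ι →₀ Aᵐᵒᵖ) X, ∃ s₀ : Finset ι, ∀ s, s₀ ⊆ s →
      Tens.map (p s) (LinearMap.id (R := A)) z = z := fun z => by
    induction z using Tens.induction_on with
    | zero => exact ⟨∅, fun s _ => map_zero _⟩
    | tmul v x => exact ⟨v.support, fun s hs => by rw [Tens.map_tmul, hp s v hs]; rfl⟩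
    | add x y hx hy =>
      obtain ⟨s, hs⟩ := hx
      obtain ⟨t, ht⟩ := hy
      exact ⟨s ∪ t, fun r hr => by
        rw [map_add, hs r (Finset.union_subset_left hr), ht r (Finset.union_subset_right hr)]⟩
  rw [injective_iff_map_eq_zero]
  intro z hz
  obtain ⟨s, hs⟩ := hs z
  rw [← hs s subset_rfl, Tens.map_sum_left]
  refine Finset.sum_eq_zero fun i _ => ?_
  rw [Tens.map_comp_left]
  have : Tens.map (Finsupp.lapply i : (ι →₀ Aᵐᵒᵖ) →ₗ[Aᵐᵒᵖ] Aᵐᵒᵖ) (LinearMap.id (R := A)) z = 0 := by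
    refine (injective_iff_map_eq_zero _).1 (Tens.map_injective_op f hf) _ ?_
    have h := congrArg (Tens.map (Finsupp.lapply i : (ι →₀ Aᵐᵒᵖ) →ₗ[Aᵐᵒᵖ] Aᵐᵒᵖ)
      (LinearMap.id (R := A) (M := Y))) hz
    rw [Tens.map_map, map_zero] at h
    rw [Tens.map_map]
    exact h
  rw [this, map_zero]

/-- Every right module `M` over a von Neumann regular ring is flat. Write `M = P / K` with `P` free.
If `z ∈ P ⊗ X` vanishes in `M ⊗ Y`, it vanishes in `P / L ⊗ Y` for a finitely generated `L ≤ K`;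
as `P / L` is a direct summand of `P`, it vanishes in `P / L ⊗ X`, hence in `M ⊗ X`. -/
theorem IsVonNeumannRegular.isFlatRight (hA : IsVonNeumannRegular A) (M : Type u) [AddCommGroup M]
    [Module Aᵐᵒᵖ M] : IsFlatRight A M := by
  intro X Y _ _ _ _ f hf
  let π : (M →₀ Aᵐᵒᵖ) →ₗ[Aᵐᵒᵖ] M := Finsupp.linearCombination Aᵐᵒᵖ id
  have hπ : Function.Surjective π := Finsupp.linearCombination_id_surjective Aᵐᵒᵖ M
  have hlift : ∀ z : Tens A M X, ∃ w, Tens.map π (LinearMap.id (R := A)) w = z := fun z => by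
    induction z using Tens.induction_on with
    | zero => exact ⟨0, map_zero _⟩
    | tmul m x =>
      obtain ⟨v, rfl⟩ := hπ m
      exact ⟨Tens.tmul A v x, rfl⟩
    | add x y hx hy =>
      obtain ⟨v, rfl⟩ := hx
      obtain ⟨w, rfl⟩ := hy
      exact ⟨v + w, map_add _ _ _⟩
  have hfg : ∀ z : Tens A (LinearMap.ker π) Y, ∃ L₀ ≤ LinearMap.ker π, L₀.FG ∧ ∀ L, L₀ ≤ L →
      Tens.map (L.mkQ ∘ₗ (LinearMap.ker π).subtype) (LinearMap.id (R := A)) z = 0 := fun z => by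
    induction z using Tens.induction_on with
    | zero => exact ⟨⊥, bot_le, Submodule.fg_bot, fun L _ => map_zero _⟩
    | tmul v y =>
      refine ⟨Submodule.span _ {v.1}, ?_, Submodule.fg_span_singleton _, fun L hL => ?_⟩
      · rw [Submodule.span_singleton_le_iff_mem]
        exact v.2
      · have : L.mkQ v.1 = 0 := by
          rw [Submodule.mkQ_apply, Submodule.Quotient.mk_eq_zero]
          exact hL (Submodule.mem_span_singleton_self _)
        rw [Tens.map_tmul, LinearMap.comp_apply, Submodule.subtype_apply, this, Tens.zero_tmul]
    | add x y hx hy =>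
      obtain ⟨L₁, h₁, h₁', h₁''⟩ := hx
      obtain ⟨L₂, h₂, h₂', h₂''⟩ := hy
      exact ⟨L₁ ⊔ L₂, sup_le h₁ h₂, h₁'.sup h₂', fun L hL => by
        rw [map_add, h₁'' L (le_sup_left.trans hL), h₂'' L (le_sup_right.trans hL), add_zero]⟩
  rw [injective_iff_map_eq_zero]
  intro z hz
  obtain ⟨w, rfl⟩ := hlift z
  rw [Tens.map_map] at hz
  have hz' : Tens.map π (LinearMap.id (R := A))
      (Tens.map (LinearMap.id (R := Aᵐᵒᵖ)) f w) = 0 := by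
    rw [Tens.map_map]
    exact hz
  obtain ⟨v, hv⟩ := Tens.exists_map_eq_of_exact (LinearMap.ker π).subtype π hπ
    (fun x hx => ⟨(⟨x, hx⟩ : LinearMap.ker π), rfl⟩) _ hz'
  obtain ⟨L, hLK, hL, hL'⟩ := hfg v
  obtain ⟨s, hs⟩ := L.exists_mkQ_section hA.mulOpposite hL
  have h₁ : Tens.map L.mkQ (LinearMap.id (R := A) (M := X)) w = 0 := by
    have h₂ : Tens.map L.mkQ f w = 0 := by
      have := hL' L le_rfl
      rw [Tens.map_comp_left, hv, Tens.map_map] at this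
      exact this
    have h₃ : Tens.map (s ∘ₗ L.mkQ) (LinearMap.id (R := A) (M := X)) w = 0 := by
      refine (injective_iff_map_eq_zero _).1 (Tens.map_injective_finsupp f hf) _ ?_
      have := congrArg (Tens.map s (LinearMap.id (R := A) (M := Y))) h₂
      rw [Tens.map_map, map_zero] at this
      rw [Tens.map_map]
      exact this
    have := congrArg (Tens.map L.mkQ (LinearMap.id (R := A) (M := X))) h₃
    rw [← Tens.map_comp_left, ← LinearMap.comp_assoc, hs, LinearMap.id_comp, map_zero] at this
    exact this
  have := congrArg (Tens.map (L.liftQ π hLK) (LinearMap.id (R := A) (M := X))) h₁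
  rwa [← Tens.map_comp_left, Submodule.liftQ_mkQ, map_zero] at this

end Flat

/-! ### Colimits of modules -/

section ModuleColimits

variable {R : Type u} [Ring R]

/-- A cocone over a filtered diagram of modules is a colimit if it is jointly surjective and each
element of its kernel dies at a later stage. -/
noncomputable def ModuleCat.isColimitOfFiltered {J : Type u} [SmallCategory J] [IsFiltered J]
    {K : J ⥤ ModuleCat.{u} R} (c : Cocone K) (hsurj : ∀ x : c.pt, ∃ j y, c.ι.app j y = x)
    (hinj : ∀ j (y : K.obj j), c.ι.app j y = 0 → ∃ (j' : J) (f : j ⟶ j'), K.map f y = 0) :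
    IsColimit c :=
  isColimitOfReflects (forget (ModuleCat.{u} R)) (Types.FilteredColimit.isColimitOf'
    (K ⋙ forget (ModuleCat.{u} R)) _
    (fun x => by
      obtain ⟨j, y, hy⟩ := hsurj x
      exact ⟨j, y, hy.symm⟩)
    (fun j x y hxy => by
      obtain ⟨j', f, hf⟩ := hinj j (x - y) (by
        rw [map_sub]
        exact sub_eq_zero.2 hxy)
      rw [map_sub] at hf
      exact ⟨j', f, sub_eq_zero.1 hf⟩))

variable {X : Type u} [AddCommGroup X] [Module R X] {J : Type u} [Preorder J]

/-- The diagram of an increasing family of submodules, with its cocone to the whole module. -/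
def submoduleCocone (N : J →o Submodule R X) :
    Cocone ({ obj := fun j => ModuleCat.of R (N j)
              map := fun f => ModuleCat.ofHom (Submodule.inclusion (N.monotone f.le))
              map_id := fun _ => rfl
              map_comp := fun _ _ => rfl } : J ⥤ ModuleCat.{u} R) where
  pt := ModuleCat.of R X
  ι := { app := fun j => ModuleCat.ofHom (N j).subtype
         naturality := fun _ _ _ => rfl }

/-- The diagram of the quotients by an increasing family of submodules of the kernel of `π`, with
its cocone to the codomain of `π`. -/
def quotientCocone (L : J →o Submodule R X) {Y : Type u} [AddCommGroup Y] [Module R Y]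
    (π : X →ₗ[R] Y) (hL : ∀ j, L j ≤ LinearMap.ker π) :
    Cocone ({ obj := fun j => ModuleCat.of R (X ⧸ L j)
              map := fun f => ModuleCat.ofHom (Submodule.factor (L.monotone f.le))
              map_id := fun _ => ModuleCat.hom_ext (Submodule.linearMap_qext _ rfl)
              map_comp := fun _ _ => ModuleCat.hom_ext (Submodule.linearMap_qext _ rfl) } :
      J ⥤ ModuleCat.{u} R) where
  pt := ModuleCat.of R Y
  ι := { app := fun j => ModuleCat.ofHom ((L j).liftQ π (hL j))
         naturality := fun _ _ _ => ModuleCat.hom_ext (Submodule.linearMap_qext _ rfl) }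

variable [IsDirectedOrder J] [Nonempty J]

theorem nonempty_isColimit_submoduleCocone (N : J →o Submodule R X) (hN : ∀ x, ∃ j, x ∈ N j) :
    Nonempty (IsColimit (submoduleCocone N)) :=
  ⟨ModuleCat.isColimitOfFiltered _
    (fun x => by
      obtain ⟨j, hj⟩ := hN x
      exact ⟨j, ⟨x, hj⟩, rfl⟩)
    (fun j y hy => ⟨j, 𝟙 j, Subtype.ext hy⟩)⟩

theorem nonempty_isColimit_quotientCocone (L : J →o Submodule R X) {Y : Type u} [AddCommGroup Y]
    [Module R Y] (π : X →ₗ[R] Y) (hL : ∀ j, L j ≤ LinearMap.ker π)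
    (hπ : Function.Surjective π) (hL' : ∀ x ∈ LinearMap.ker π, ∃ j, x ∈ L j) :
    Nonempty (IsColimit (quotientCocone L π hL)) :=
  ⟨ModuleCat.isColimitOfFiltered _
    (fun y => by
      obtain ⟨x, rfl⟩ := hπ y
      exact ⟨Classical.arbitrary J, Submodule.Quotient.mk x, rfl⟩)
    (fun j y hy => by
      obtain ⟨x, rfl⟩ := (L j).mkQ_surjective y
      obtain ⟨j', hj'⟩ := hL' x hy
      obtain ⟨i, hji, hj'i⟩ := exists_ge_ge j j'
      exact ⟨i, homOfLE hji, (Submodule.Quotient.mk_eq_zero _).2 (L.monotone hj'i hj')⟩)⟩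

/-- The free module on `I` is the coproduct of `I` copies of the ring. -/
noncomputable def finsuppIsColimit (R : Type u) [Ring R] (I : Type u) :
    IsColimit (Cofan.mk (ModuleCat.of R (I →₀ R))
      (fun i => ModuleCat.ofHom (Finsupp.lsingle i : R →ₗ[R] I →₀ R))) :=
  Cofan.IsColimit.mk _ (fun s => ModuleCat.ofHom (Finsupp.lsum ℕ fun i => (s.inj i).hom))
    (fun s i => by
      ext
      simp)
    (fun s m hm => by
      refine ModuleCat.hom_ext (Finsupp.lhom_ext' fun i => ?_)
      refine (congrArg ModuleCat.Hom.hom (hm i)).trans ?_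
      ext
      simp)

end ModuleColimits

/-! ### The modules at which `Υ` is an isomorphism -/

section UpsilonIsIso

variable {T : Type u} [Ring T] [Algebra k T]
variable {B : Type u} [Ring B] [Algebra k B] {D : Coring k B}
variable (F : RComod C ⥤ RComod D) [F.Additive] [F.Linear k] (M : LRComod T C)
variable {X Y : Type u} [AddCommGroup X] [Module Tᵐᵒᵖ X] [AddCommGroup Y] [Module Tᵐᵒᵖ Y]

theorem isIso_upsilon_of_retract (i : X →ₗ[Tᵐᵒᵖ] Y) (p : Y →ₗ[Tᵐᵒᵖ] X)
    (hip : p ∘ₗ i = LinearMap.id) (h : IsIso (upsilon F Y M)) : IsIso (upsilon F X M) :=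
  isIso_upsilon_of_sum F M (ι := Unit) (fun _ => Y) (fun _ => p) (fun _ => i) (by simpa using hip)
    fun _ => h

theorem isIso_upsilon_op : IsIso (upsilon F Tᵐᵒᵖ M) :=
  isIso_upsilon_of_retract F M (opRightEquiv T).toLinearMap (opRightEquiv T).symm.toLinearMap
    (LinearEquiv.symm_comp _) (isIso_upsilon_unit F M)

theorem isIso_upsilon_finsupp_of_coproducts (hF : PreservesCoproducts F) (I : Type u) :
    IsIso (upsilon F (I →₀ Tᵐᵒᵖ) M) :=
  have := hF I
  isIso_upsilon_of_isColimit F M (finsuppIsColimit Tᵐᵒᵖ I) fun _ => isIso_upsilon_op F M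

/-- A free module is the direct limit of its finitely generated coordinate submodules. -/
theorem isIso_upsilon_finsupp_of_directLimits (hF : PreservesDirectLimits F) (I : Type u) :
    IsIso (upsilon F (I →₀ Tᵐᵒᵖ) M) := by
  classical
  let N : Finset I →o Submodule Tᵐᵒᵖ (I →₀ Tᵐᵒᵖ) :=
    ⟨fun s => Finsupp.supported Tᵐᵒᵖ Tᵐᵒᵖ (s : Set I), fun s t h =>
      Finsupp.supported_mono (Finset.coe_subset.2 h)⟩
  have := hF (Finset I)
  obtain ⟨hc⟩ := nonempty_isColimit_submoduleCocone N fun x =>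
    ⟨x.support, (Finsupp.mem_supported Tᵐᵒᵖ x).2 subset_rfl⟩
  refine isIso_upsilon_of_isColimit F M hc fun s => ?_
  refine isIso_upsilon_of_sum F M (X := N s) (ι := s) (fun _ => Tᵐᵒᵖ)
    (fun i => LinearMap.codRestrict _ (Finsupp.lsingle i.1) fun x =>
      Finsupp.single_mem_supported _ _ i.2)
    (fun i => Finsupp.lapply i.1 ∘ₗ (N s).subtype) ?_ fun _ => isIso_upsilon_op F M
  refine LinearMap.ext fun x => Subtype.ext ?_
  have hx : x.1.support ⊆ s := Finset.coe_subset.1 ((Finsupp.mem_supported Tᵐᵒᵖ x.1).1 x.2)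
  rw [LinearMap.sum_apply, AddSubmonoidClass.coe_finsetSum]
  change ∑ i : s, Finsupp.single i.1 (x.1 i.1) = x.1
  rw [Finset.sum_coe_sort s fun i => Finsupp.single i (x.1 i)]
  exact (Finsupp.sum_of_support_subset x.1 hx _ (by simp)).symm.trans x.1.sum_single

theorem isIso_upsilon_of_projective (h : ∀ I : Type u, IsIso (upsilon F (I →₀ Tᵐᵒᵖ) M))
    [Module.Projective Tᵐᵒᵖ X] : IsIso (upsilon F X M) := by
  obtain ⟨s, hs⟩ := Module.projective_lifting_property
    (Finsupp.linearCombination Tᵐᵒᵖ (id : X → X)) LinearMap.id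
    (Finsupp.linearCombination_id_surjective _ _)
  exact isIso_upsilon_of_retract F M s _ hs (h X)

/-- If `F` preserves colimits, then `Υ` is an isomorphism at every module, since every module is the
cokernel of a map of free modules. -/
theorem isIso_upsilon_of_preservesColimits (hF : PreservesColimits F) :
    IsIso (upsilon F X M) := by
  have hfree := isIso_upsilon_finsupp_of_coproducts F M (fun J => inferInstance)
  let π : (X →₀ Tᵐᵒᵖ) →ₗ[Tᵐᵒᵖ] X := Finsupp.linearCombination Tᵐᵒᵖ id
  let f : (LinearMap.ker π →₀ Tᵐᵒᵖ) →ₗ[Tᵐᵒᵖ] X →₀ Tᵐᵒᵖ :=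
    (LinearMap.ker π).subtype ∘ₗ Finsupp.linearCombination Tᵐᵒᵖ id
  have hex : Function.Exact f π := by
    rw [LinearMap.exact_iff, LinearMap.range_comp_of_range_eq_top, Submodule.range_subtype]
    exact LinearMap.range_eq_top.2 (Finsupp.linearCombination_id_surjective _ _)
  have : PreservesColimitsOfSize.{0, 0} F := preservesColimitsOfSize_shrink F
  refine isIso_upsilon_of_isColimit F M (ModuleCat.isColimitCokernelCofork (ModuleCat.ofHom f)
    (ModuleCat.ofHom π) hex (Finsupp.linearCombination_id_surjective _ _)) fun j => ?_
  cases j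
  · exact hfree _
  · exact hfree _

/-- Over a von Neumann regular ring, `Υ` is an isomorphism at every module if `F` preserves direct
limits: a quotient `P / K` of a free module `P` is the direct limit of the quotients `P / L` for
finitely generated `L ≤ K`, and these are direct summands of `P`. -/
theorem IsVonNeumannRegular.isIso_upsilon (hT : IsVonNeumannRegular T)
    (hF : PreservesDirectLimits F) : IsIso (upsilon F X M) := by
  let π : (X →₀ Tᵐᵒᵖ) →ₗ[Tᵐᵒᵖ] X := Finsupp.linearCombination Tᵐᵒᵖ id
  let J := {L : Submodule Tᵐᵒᵖ (X →₀ Tᵐᵒᵖ) // L.FG ∧ L ≤ LinearMap.ker π}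
  have : Nonempty J := ⟨⊥, Submodule.fg_bot, bot_le⟩
  have : IsDirectedOrder J := ⟨fun L L' =>
    ⟨⟨L.1 ⊔ L'.1, L.2.1.sup L'.2.1, sup_le L.2.2 L'.2.2⟩, le_sup_left (a := L.1),
      le_sup_right (a := L.1)⟩⟩
  have := hF J
  obtain ⟨hc⟩ := nonempty_isColimit_quotientCocone (J := J) ⟨Subtype.val, fun _ _ h => h⟩ π
    (fun L => L.2.2) (Finsupp.linearCombination_id_surjective _ _) fun x hx =>
      ⟨⟨Submodule.span _ {x}, Submodule.fg_span_singleton _,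
        (Submodule.span_singleton_le_iff_mem _ _).2 hx⟩, Submodule.mem_span_singleton_self _⟩
  refine isIso_upsilon_of_isColimit F M hc fun L => ?_
  obtain ⟨s, hs⟩ := L.1.exists_mkQ_section hT.mulOpposite L.2.1
  exact isIso_upsilon_of_retract F M s L.1.mkQ hs (isIso_upsilon_finsupp_of_directLimits F M hF X)

end UpsilonIsIso

end Corings

/-- A representation theorem of Eilenberg–Watts type for `k`-linear functors between categories of
comodules over corings. The first conjunct is the main statement; the other three are the examples
of situations in which the alternatives (1), (2) and (3) hold. -/
theorem theorem3 {k A B : Type u} [CommRing k] [Ring A] [Algebra k A] [Ring B] [Algebra k B]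
    (C : Coring k A) (D : Coring k B) (F : RComod C ⥤ RComod D) [F.Additive] [F.Linear k] :
    ( -- alternatives (I) and (II)
      (IsFlatLeft B D ∧ ∀ N : RComod C, PreservesLimit (parallelPair N.omegaC 0) F) ∨
      (C.IsCoseparable ∧ Nonempty (Abelian (RComod C)) ∧ Nonempty (Abelian (RComod D))) →
      -- alternatives (1), (2) and (3)
      (Module.Projective Aᵐᵒᵖ C ∧ PreservesCoproducts F ∧ UpsilonIso F) ∨
      (IsFlatRight A C ∧ PreservesDirectLimits F ∧ UpsilonIso F) ∨
      PreservesColimits F →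
      -- conclusion
      ∃ lam : LeftCoaction C (C.regular.mapFunctor F),
        (∀ y : C.regular.mapFunctor F,
          (upsilon F C C.regular).lin (lam.coact y) = (F.map C.comulHom).lin y) ∧
        ∃ h : lam.IsCotensorable, Nonempty (F ≅ h.functor)) ∧
    -- examples for (1), (2) and (3)
    (IsSemisimpleRing A → PreservesCoproducts F →
      Module.Projective Aᵐᵒᵖ C ∧ PreservesCoproducts F ∧ UpsilonIso F) ∧
    (IsVonNeumannRegular A → PreservesDirectLimits F →
      IsFlatRight A C ∧ PreservesDirectLimits F ∧ UpsilonIso F) ∧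
    (F.IsLeftAdjoint → PreservesColimits F) := by
  have colim (hF : PreservesColimits F) : UpsilonIso F := fun N =>
    ⟨isIso_upsilon_of_preservesColimits F C.regular hF,
      isIso_upsilon_of_preservesColimits F C.regular hF⟩
  refine ⟨fun h₁ h₂ => exists_leftCoaction_iso_cotensor F ?_ (h₁.imp_right And.left),
    fun hA hF => ⟨Module.projective_of_isSemisimpleRing Aᵐᵒᵖ C, hF, fun N => ?_⟩,
    fun hA hF => ⟨hA.isFlatRight C, hF, fun N =>
      ⟨hA.isIso_upsilon F C.regular hF, hA.isIso_upsilon F C.regular hF⟩⟩,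
    fun hF => (Adjunction.ofIsLeftAdjoint F).leftAdjoint_preservesColimits⟩
  · rcases h₂ with ⟨-, -, hU⟩ | ⟨-, -, hU⟩ | hF
    exacts [hU, hU, colim hF]
  · have hfree := isIso_upsilon_finsupp_of_coproducts F C.regular hF
    have hproj (X : Type u) [AddCommGroup X] [Module Aᵐᵒᵖ X] : Module.Projective Aᵐᵒᵖ X :=
      Module.projective_of_isSemisimpleRing Aᵐᵒᵖ X
    have := hproj N
    have := hproj (Tens A N C)
    exact ⟨isIso_upsilon_of_projective F C.regular hfree,
      isIso_upsilon_of_projective F C.regular hfree⟩
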